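/- Let $n\ge 1$, let $\mathscr X\subset\mathbb R^n$ be a bounded open set with smooth boundary $\partial\mathscr X$, and let $b:\mathbb R^n\to\mathbb R^n$ and $B:\mathbb R^n\to\mathbb R^{n\times m}$ be continuous, with $B(y)$ of rank $n$ for every $y$. Put $a_{ij}=\frac12\sum_{k=1}^m B_{ik}B_{jk}$ and $$Lf:=-\Big(\sum_{i,j=1}^n a_{ij}\,\partial_i\partial_j f+\sum_{i=1}^n b_i\,\partial_i f\Big).$$ Let $g:\partial\mathscr X\to\mathbb R$ be continuous and let $x\in\mathscr X$. Call a pair $(\mu,\nu)$ admissible if $\mu,\nu$ are finite nonnegative Borel measures carried by $\mathscr X$ and $\partial\mathscr X$ respectively; an admissible pair satisfies $\nu+L'\mu=\delta_x$ if $\int f\,d\nu+\int Lf\,d\mu=f(x)$ for all $f\in C^2(\overline{\mathscr X})$ (restrictions to $\overline{\mathscr X}$ of $C^2$ functions on $\mathbb R^n$). Consider $$v_{\min}(x)=\min_{\mu,\nu}\int g\,d\nu\ \ \text{s.t. } \nu+L'\mu=\delta_x,\qquad v_{\max}(x)=\max_{\mu,\nu}\int g\,d\nu\ \ \text{s.t.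 } \nu+L'\mu=\delta_x,$$ over admissible pairs, with the Lagrangian $\ell(\mu,\nu,v)=\int g\,d\nu+v(x)-\int v\,d\nu-\int Lv\,d\mu$, $v\in C^2(\overline{\mathscr X})$. (1) The dual of the minimization problem is $$\sup_v\ v(x)\quad\text{s.t. } Lv\le 0\text{ in }\mathscr X,\quad v\le g\text{ on }\partial\mathscr X.$$ That is, for $v\in C^2(\overline{\mathscr X})$, the infimum of $\ell(\mu,\nu,v)$ over all admissible pairs is $v(x)$ if $v$ satisfies these constraints, and $-\infty$ otherwise. There is no duality gap: the minimum $v_{\min}(x)$ is finite and attained, and it equals the value (the supremum, which need not be attained) of the dual problem, whether $v$ ranges over $C^2(\overline{\mathscr X})$ or over $C^2(\mathscr X)\cap C(\overline{\mathscr X})$. (2) The dual of the maximization problem is $$\inf_v\ v(x)\quad\text{s.t. } Lv\ge 0\text{ in }\mathscr X,\quad v\ge g\text{ on }\partial\mathscr X.$$ That is, for $v\in C^2(\overline{\mathscr X})$, the supremum of $\ell(\mu,\nu,v)$ over all admissible pairs is $v(x)$ if $v$ satisfies these constraints, and $+\infty$ otherwise. There is no duality gap: the maximum $v_{\max}(x)$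 is finite and attained, and it equals the value (the infimum, which need not be attained) of the dual problem, for $v$ in either of these two classes. -/

import Mathlib

open MeasureTheory Set
open scoped ContDiff

namespace ExitLP

/-- An open set `X` has smooth boundary: near every boundary point, `X` is the strict sublevel set
of a smooth function with nonvanishing differential at that point. -/
def HasSmoothBoundary {n : ℕ} (X : Set (EuclideanSpace ℝ (Fin n))) : Prop :=
  ∀ z ∈ frontier X, ∃ (U : Set (EuclideanSpace ℝ (Fin n))) (ρ : EuclideanSpace ℝ (Fin n) → ℝ),
    IsOpen U ∧ z ∈ U ∧ ContDiffOn ℝ ∞ ρ U ∧ fderiv ℝ ρ z ≠ 0 ∧ X ∩ U = {y ∈ U | ρ y < 0}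

/-- The partial derivative `∂ᵢ f`. -/
noncomputable def partialD {n : ℕ} (i : Fin n) (f : EuclideanSpace ℝ (Fin n) → ℝ) :
    EuclideanSpace ℝ (Fin n) → ℝ :=
  fun y => fderiv ℝ f y (EuclideanSpace.single i 1)

/-- The diffusion matrix `A = ½ B Bᵀ`. -/
noncomputable def diffusion {n m : ℕ}
    (B : EuclideanSpace ℝ (Fin n) → Matrix (Fin n) (Fin m) ℝ) (y : EuclideanSpace ℝ (Fin n)) :
    Matrix (Fin n) (Fin n) ℝ :=
  fun i j => (1 / 2) * ∑ k, B y i k * B y j k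

/-- The operator `L f = - (∑ᵢⱼ aᵢⱼ ∂ᵢ ∂ⱼ f + ∑ᵢ bᵢ ∂ᵢ f)`, minus the generator of
`dX = b(X) dt + B(X) dW`. -/
noncomputable def opL {n m : ℕ} (b : EuclideanSpace ℝ (Fin n) → EuclideanSpace ℝ (Fin n))
    (B : EuclideanSpace ℝ (Fin n) → Matrix (Fin n) (Fin m) ℝ)
    (f : EuclideanSpace ℝ (Fin n) → ℝ) (y : EuclideanSpace ℝ (Fin n)) : ℝ :=
  -(∑ i, ∑ j, diffusion B y i j * partialD i (partialD j f) y + ∑ i, b y i * partialD i f y)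

/-- Pairs `(μ, ν)` of finite (nonnegative) Borel measures, `μ` carried by `X` and `ν` by `∂X`. -/
def measurePairs {n : ℕ} (X : Set (EuclideanSpace ℝ (Fin n))) :
    Set (Measure (EuclideanSpace ℝ (Fin n)) × Measure (EuclideanSpace ℝ (Fin n))) :=
  {p | IsFiniteMeasure p.1 ∧ IsFiniteMeasure p.2 ∧ p.1 Xᶜ = 0 ∧ p.2 (frontier X)ᶜ = 0}

/-- The constraint `ν + L' μ = δ_x`, tested against `C²(closure X)`, that is, against the
restrictions to `closure X` of `C²` functions on the whole space. -/
def Kolmogorov {n m : ℕ} (b : EuclideanSpace ℝ (Fin n) → EuclideanSpace ℝ (Fin n))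
    (B : EuclideanSpace ℝ (Fin n) → Matrix (Fin n) (Fin m) ℝ) (x : EuclideanSpace ℝ (Fin n))
    (μ ν : Measure (EuclideanSpace ℝ (Fin n))) : Prop :=
  ∀ f : EuclideanSpace ℝ (Fin n) → ℝ, ContDiff ℝ 2 f →
    ∫ y, f y ∂ν + ∫ y, opL b B f y ∂μ = f x

/-- The objective values `⟨g, ν⟩` of the feasible points of the measure problem. -/
def primalValues {n m : ℕ} (X : Set (EuclideanSpace ℝ (Fin n)))
    (b : EuclideanSpace ℝ (Fin n) → EuclideanSpace ℝ (Fin n))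
    (B : EuclideanSpace ℝ (Fin n) → Matrix (Fin n) (Fin m) ℝ)
    (g : EuclideanSpace ℝ (Fin n) → ℝ) (x : EuclideanSpace ℝ (Fin n)) : Set ℝ :=
  {c | ∃ p ∈ measurePairs X, Kolmogorov b B x p.1 p.2 ∧ c = ∫ y, g y ∂p.2}

/-- The Lagrangian `⟨g, ν⟩ + ⟨v, δ_x - ν - L' μ⟩` of the measure problem. -/
noncomputable def lagrangian {n m : ℕ}
    (b : EuclideanSpace ℝ (Fin n) → EuclideanSpace ℝ (Fin n))
    (B : EuclideanSpace ℝ (Fin n) → Matrix (Fin n) (Fin m) ℝ)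
    (g : EuclideanSpace ℝ (Fin n) → ℝ) (x : EuclideanSpace ℝ (Fin n))
    (p : Measure (EuclideanSpace ℝ (Fin n)) × Measure (EuclideanSpace ℝ (Fin n)))
    (v : EuclideanSpace ℝ (Fin n) → ℝ) : ℝ :=
  ∫ y, g y ∂p.2 + (v x - ∫ y, v y ∂p.2 - ∫ y, opL b B v y ∂p.1)

/-- The Lagrange dual function of the minimization problem, with values in `[-∞, ∞]`. -/
noncomputable def dualFunMin {n m : ℕ} (X : Set (EuclideanSpace ℝ (Fin n)))
    (b : EuclideanSpace ℝ (Fin n) → EuclideanSpace ℝ (Fin n))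
    (B : EuclideanSpace ℝ (Fin n) → Matrix (Fin n) (Fin m) ℝ)
    (g : EuclideanSpace ℝ (Fin n) → ℝ) (x : EuclideanSpace ℝ (Fin n))
    (v : EuclideanSpace ℝ (Fin n) → ℝ) : EReal :=
  ⨅ p ∈ measurePairs X, (lagrangian b B g x p v : EReal)

/-- The Lagrange dual function of the maximization problem, with values in `[-∞, ∞]`. -/
noncomputable def dualFunMax {n m : ℕ} (X : Set (EuclideanSpace ℝ (Fin n)))
    (b : EuclideanSpace ℝ (Fin n) → EuclideanSpace ℝ (Fin n))
    (B : EuclideanSpace ℝ (Fin n) → Matrix (Fin n) (Fin m) ℝ)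
    (g : EuclideanSpace ℝ (Fin n) → ℝ) (x : EuclideanSpace ℝ (Fin n))
    (v : EuclideanSpace ℝ (Fin n) → ℝ) : EReal :=
  ⨆ p ∈ measurePairs X, (lagrangian b B g x p v : EReal)

/-- The constraints `L v ≤ 0` in `X` and `v ≤ g` on `∂X`. -/
def IsSub {n m : ℕ} (X : Set (EuclideanSpace ℝ (Fin n)))
    (b : EuclideanSpace ℝ (Fin n) → EuclideanSpace ℝ (Fin n))
    (B : EuclideanSpace ℝ (Fin n) → Matrix (Fin n) (Fin m) ℝ)
    (g v : EuclideanSpace ℝ (Fin n) → ℝ) : Prop :=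
  (∀ y ∈ X, opL b B v y ≤ 0) ∧ ∀ y ∈ frontier X, v y ≤ g y

/-- The constraints `L v ≥ 0` in `X` and `v ≥ g` on `∂X`. -/
def IsSuper {n m : ℕ} (X : Set (EuclideanSpace ℝ (Fin n)))
    (b : EuclideanSpace ℝ (Fin n) → EuclideanSpace ℝ (Fin n))
    (B : EuclideanSpace ℝ (Fin n) → Matrix (Fin n) (Fin m) ℝ)
    (g v : EuclideanSpace ℝ (Fin n) → ℝ) : Prop :=
  (∀ y ∈ X, 0 ≤ opL b B v y) ∧ ∀ y ∈ frontier X, g y ≤ v y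

/-- The class `C²(X) ∩ C(closure X)`: twice continuously differentiable in the open set `X`, with
continuous boundary values. -/
def IsC2 {n : ℕ} (X : Set (EuclideanSpace ℝ (Fin n))) (v : EuclideanSpace ℝ (Fin n) → ℝ) : Prop :=
  ContDiffOn ℝ 2 v X ∧ ContinuousOn v (closure X)

end ExitLP

/-! The minimization problem is the maximization problem for `-g` with `v` replaced by `-v`, so only
the latter is argued. Its Lagrangian is v(x) + ∫(g - v) dν - ∫Lv dμ. The zero pair gives v(x), a
supersolution can only lose from other pairs, and a large Dirac mass at a point of violation sends
the value to infinity.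

Strong duality comes from an algebraic Hahn-Banach argument. Let p(h, k) be the infimum of v(x) over
C² functions with Lv ≥ h on the closure of X and v ≥ k on ∂X. A strict supersolution makes the
constraint set nonempty, the weak maximum principle bounds p below, and p is sublinear. A linear
functional Λ ≤ p that agrees with p at (0, g) is positive, hence by Riesz a pair of measures.
Applying Λ ≤ p to both f and -f yields ν + L'μ = δ_x, and ∫g dν = p(0, g) is the dual value. Weak
duality makes this pair optimal.

This μ lives on the closure of X, and it must be shown not to charge ∂X. For a local defining
function w, the test functions ε√(ε² + w²) tend to 0, while their images under L tend boundedly to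
-1_{w=0} ∇wᵀA∇w. Hence ∇wᵀA∇w = 0 μ-almost everywhere on {w = 0}, and ellipticity with ∇w ≠ 0 gives
μ(∂X) = 0.

Enlarging the dual class to C²(X) ∩ C(closure X) does not change its value. Exterior-ball barriers,
compactness and a smoothed minimum produce a global C² supersolution u with g ≤ u < g + δ/2 on ∂X.
For v in the larger class, the smoothed minimum of u and v + δ/2 equals u near ∂X, so it extends by
u to a C² supersolution that is at most v + δ in X. -/

namespace ExitLP

open Filter Topology

/-! ### Calculus of partial derivatives -/

section Calculus

variable {n m : ℕ} {f h w : EuclideanSpace ℝ (Fin n) → ℝ} {y : EuclideanSpace ℝ (Fin n)}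

theorem eventuallyEq_partialD (i : Fin n) (hfh : f =ᶠ[𝓝 y] h) :
    partialD i f =ᶠ[𝓝 y] partialD i h := by
  filter_upwards [hfh.fderiv (𝕜 := ℝ)] with z hz
  simp only [partialD, hz]

theorem contDiffAt_partialD (i : Fin n) (hf : ContDiffAt ℝ 2 f y) :
    ContDiffAt ℝ 1 (partialD i f) y :=
  (hf.fderiv_right (m := 1) (by norm_num)).clm_apply contDiffAt_const

theorem eventually_contDiffAt (hf : ContDiffAt ℝ 2 f y) : ∀ᶠ z in 𝓝 y, ContDiffAt ℝ 2 f z :=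
  hf.eventually (by simp)

theorem eventually_differentiableAt (hf : ContDiffAt ℝ 2 f y) :
    ∀ᶠ z in 𝓝 y, DifferentiableAt ℝ f z := by
  filter_upwards [eventually_contDiffAt hf] with z hz
  exact hz.differentiableAt (by norm_num)

theorem partialD_add (i : Fin n) (hf : DifferentiableAt ℝ f y) (hh : DifferentiableAt ℝ h y) :
    partialD i (fun z => f z + h z) y = partialD i f y + partialD i h y := by
  simp only [partialD]
  rw [fderiv_fun_add hf hh]; rfl

theorem partialD_const_mul (i : Fin n) (c : ℝ) (hf : DifferentiableAt ℝ f y) :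
    partialD i (fun z => c * f z) y = c * partialD i f y := by
  simp only [partialD]
  rw [fderiv_const_mul hf]; rfl

theorem partialD_partialD_add (i j : Fin n) (hf : ContDiffAt ℝ 2 f y) (hh : ContDiffAt ℝ 2 h y) :
    partialD i (partialD j fun z => f z + h z) y
      = partialD i (partialD j f) y + partialD i (partialD j h) y := by
  have e : partialD j (fun z => f z + h z) =ᶠ[𝓝 y] fun z => partialD j f z + partialD j h z := by
    filter_upwards [eventually_differentiableAt hf, eventually_differentiableAt hh] with z h1 h2
    exact partialD_add j h1 h2
  rw [(eventuallyEq_partialD i e).eq_of_nhds]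
  exact partialD_add i ((contDiffAt_partialD j hf).differentiableAt (by norm_num))
    ((contDiffAt_partialD j hh).differentiableAt (by norm_num))

theorem partialD_partialD_const_mul (i j : Fin n) (c : ℝ) (hf : ContDiffAt ℝ 2 f y) :
    partialD i (partialD j fun z => c * f z) y = c * partialD i (partialD j f) y := by
  have e : partialD j (fun z => c * f z) =ᶠ[𝓝 y] fun z => c * partialD j f z := by
    filter_upwards [eventually_differentiableAt hf] with z h1
    exact partialD_const_mul j c h1
  rw [(eventuallyEq_partialD i e).eq_of_nhds]
  exact partialD_const_mul i c ((contDiffAt_partialD j hf).differentiableAt (by norm_num))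

theorem partialD_comp {θ θ' : ℝ → ℝ} (hθ : ∀ t, HasDerivAt θ (θ' t) t) (i : Fin n)
    (hw : DifferentiableAt ℝ w y) :
    partialD i (fun z => θ (w z)) y = θ' (w y) * partialD i w y := by
  have := (hθ (w y)).comp_hasFDerivAt y hw.hasFDerivAt
  simp only [partialD]
  rw [show (fun z => θ (w z)) = θ ∘ w from rfl, this.fderiv]
  simp

theorem partialD_partialD_comp {θ θ' θ'' : ℝ → ℝ} (hθ : ∀ t, HasDerivAt θ (θ' t) t)
    (hθ' : ∀ t, HasDerivAt θ' (θ'' t) t) (i j : Fin n) (hw : ContDiffAt ℝ 2 w y) :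
    partialD i (partialD j fun z => θ (w z)) y
      = θ' (w y) * partialD i (partialD j w) y
        + θ'' (w y) * (partialD i w y * partialD j w y) := by
  have e : partialD j (fun z => θ (w z)) =ᶠ[𝓝 y] fun z => θ' (w z) * partialD j w z := by
    filter_upwards [eventually_differentiableAt hw] with z h1
    exact partialD_comp hθ j h1
  rw [(eventuallyEq_partialD i e).eq_of_nhds]
  have hwd : DifferentiableAt ℝ w y := hw.differentiableAt (by norm_num)
  have h1 : HasFDerivAt (fun z => θ' (w z)) (θ'' (w y) • fderiv ℝ w y) y :=
    (hθ' (w y)).comp_hasFDerivAt y hwd.hasFDerivAt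
  have h2 := ((contDiffAt_partialD j hw).differentiableAt (by norm_num)).hasFDerivAt
  have h3 : HasFDerivAt (fun z => θ' (w z) * partialD j w z) _ y := h1.mul h2
  rw [partialD, h3.fderiv]
  simp only [add_apply, smul_apply, smul_eq_mul]
  change θ' (w y) * partialD i (partialD j w) y + partialD j w y * (θ'' (w y) * partialD i w y) = _
  ring

end Calculus

/-! ### The operator L and its ellipticity -/

/-- The quadratic form `ξ ↦ ξᵀ A(y) ξ` of the diffusion matrix. -/
noncomputable def quadA {n m : ℕ} (B : EuclideanSpace ℝ (Fin n) → Matrix (Fin n) (Fin m) ℝ)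
    (y : EuclideanSpace ℝ (Fin n)) (ξ : Fin n → ℝ) : ℝ :=
  ∑ i, ∑ j, diffusion B y i j * (ξ i * ξ j)

section Operator

variable {n m : ℕ} {f h w : EuclideanSpace ℝ (Fin n) → ℝ} {y : EuclideanSpace ℝ (Fin n)}
  (b : EuclideanSpace ℝ (Fin n) → EuclideanSpace ℝ (Fin n))
  (B : EuclideanSpace ℝ (Fin n) → Matrix (Fin n) (Fin m) ℝ)

theorem opL_congr (hfh : f =ᶠ[𝓝 y] h) : opL b B f y = opL b B h y := by
  unfold opL
  have h1 : ∀ i, partialD i f y = partialD i h y := fun i =>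
    (eventuallyEq_partialD i hfh).eq_of_nhds
  have h2 : ∀ i j, partialD i (partialD j f) y = partialD i (partialD j h) y := fun i j =>
    (eventuallyEq_partialD i (eventuallyEq_partialD j hfh)).eq_of_nhds
  simp only [h1, h2]

theorem opL_add (hf : ContDiffAt ℝ 2 f y) (hh : ContDiffAt ℝ 2 h y) :
    opL b B (fun z => f z + h z) y = opL b B f y + opL b B h y := by
  unfold opL
  simp only [partialD_partialD_add _ _ hf hh, partialD_add _ (hf.differentiableAt (by norm_num))
    (hh.differentiableAt (by norm_num)), mul_add, Finset.sum_add_distrib]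
  ring

theorem opL_const_mul (c : ℝ) (hf : ContDiffAt ℝ 2 f y) :
    opL b B (fun z => c * f z) y = c * opL b B f y := by
  unfold opL
  simp only [partialD_partialD_const_mul _ _ c hf,
    partialD_const_mul _ c (hf.differentiableAt (by norm_num)), mul_neg, mul_add, Finset.mul_sum]
  congr 2 <;> refine Finset.sum_congr rfl fun i _ => ?_
  · exact Finset.sum_congr rfl fun j _ => by ring
  · ring

theorem opL_neg (hf : ContDiffAt ℝ 2 f y) :
    opL b B (fun z => - f z) y = - opL b B f y := by
  have := opL_const_mul b B (-1) hf
  simpa using this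

theorem opL_sub (hf : ContDiffAt ℝ 2 f y) (hh : ContDiffAt ℝ 2 h y) :
    opL b B (fun z => f z - h z) y = opL b B f y - opL b B h y := by
  simp only [sub_eq_add_neg]
  rw [opL_add b B hf hh.neg, opL_neg b B hh]

theorem opL_const (c : ℝ) : opL b B (fun _ => c) y = 0 := by
  have h1 : ∀ i : Fin n, partialD i (fun _ => c) = fun _ => (0 : ℝ) := by
    intro i; funext z; simp [partialD]
  have h2 : ∀ i : Fin n, partialD i (fun _ => (0 : ℝ)) = fun _ => (0 : ℝ) := by
    intro i; funext z; simp [partialD]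
  simp [opL, h1, h2]

/-- The second-order part contributes a term in θ'' with a definite sign. The exponential
supersolutions, the boundary-mass test functions and the smoothed minimum all exploit it. -/
theorem opL_comp {θ θ' θ'' : ℝ → ℝ} (hθ : ∀ t, HasDerivAt θ (θ' t) t)
    (hθ' : ∀ t, HasDerivAt θ' (θ'' t) t) (hw : ContDiffAt ℝ 2 w y) :
    opL b B (fun z => θ (w z)) y
      = θ' (w y) * opL b B w y - θ'' (w y) * quadA B y (fun i => partialD i w y) := by
  unfold opL quadA
  simp only [partialD_partialD_comp hθ hθ' _ _ hw,
    partialD_comp hθ _ (hw.differentiableAt (by norm_num)), mul_neg, mul_add,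
    Finset.sum_add_distrib, Finset.mul_sum]
  have e1 : ∀ i j, diffusion B y i j * (θ' (w y) * partialD i (partialD j w) y)
      = θ' (w y) * (diffusion B y i j * partialD i (partialD j w) y) := fun i j => by ring
  have e2 : ∀ i j, diffusion B y i j * (θ'' (w y) * (partialD i w y * partialD j w y))
      = θ'' (w y) * (diffusion B y i j * (partialD i w y * partialD j w y)) := fun i j => by ring
  have e3 : ∀ i, b y i * (θ' (w y) * partialD i w y) = θ' (w y) * (b y i * partialD i w y) :=
    fun i => by ring
  simp only [e1, e2, e3]
  ring

theorem quadA_eq (ξ : Fin n → ℝ) :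
    quadA B y ξ = (1 / 2) * ∑ k, (∑ i, B y i k * ξ i) ^ 2 := by
  unfold quadA diffusion
  simp only [sq, Finset.mul_sum, Finset.sum_mul]
  rw [Finset.sum_congr rfl fun i _ => Finset.sum_comm, Finset.sum_comm]
  exact Finset.sum_congr rfl fun k _ => Finset.sum_congr rfl fun i _ =>
    Finset.sum_congr rfl fun j _ => by ring

theorem quadA_nonneg (ξ : Fin n → ℝ) : 0 ≤ quadA B y ξ := by
  rw [quadA_eq]
  positivity

/-- The form is ½‖Bᵀξ‖², and Bᵀ has rank n, so its kernel is trivial by rank-nullity. -/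
theorem quadA_pos (hBr : (B y).rank = n) {ξ : Fin n → ℝ} (hξ : ξ ≠ 0) : 0 < quadA B y ξ := by
  refine lt_of_le_of_ne (quadA_nonneg B ξ) fun h0 => hξ ?_
  rw [quadA_eq] at h0
  have h1 : ∑ k, (∑ i, B y i k * ξ i) ^ 2 = 0 := by linarith
  have h2 : ((B y).transpose).mulVec ξ = 0 := by
    funext k
    have := (Finset.sum_eq_zero_iff_of_nonneg (fun k _ => sq_nonneg _)).1 h1 k (Finset.mem_univ k)
    simpa [Matrix.mulVec, dotProduct] using this
  have h3 : ((B y).transpose).rank = n := by rw [Matrix.rank_transpose, hBr]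
  have h4 := LinearMap.finrank_range_add_finrank_ker ((B y).transpose).mulVecLin
  rw [← Matrix.rank, h3] at h4
  simp only [Module.finrank_fintype_fun_eq_card, Fintype.card_fin, Nat.add_eq_left] at h4
  have h5 : ξ ∈ LinearMap.ker ((B y).transpose).mulVecLin :=
    LinearMap.mem_ker.2 (by rwa [Matrix.mulVecLin_apply])
  rw [Submodule.finrank_eq_zero.1 h4] at h5
  simpa using h5

theorem quadA_smul (c : ℝ) (ξ : Fin n → ℝ) :
    quadA B y (fun i => c * ξ i) = c ^ 2 * quadA B y ξ := by
  simp only [quadA, Finset.mul_sum]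
  exact Finset.sum_congr rfl fun i _ => Finset.sum_congr rfl fun j _ => by ring

variable {b B}

theorem continuous_diffusion (hB : Continuous B) (i j : Fin n) :
    Continuous fun y => diffusion B y i j := by
  unfold diffusion
  have : ∀ i k, Continuous fun y => B y i k := fun i k =>
    (continuous_apply k).comp ((continuous_apply i).comp hB)
  fun_prop

theorem continuous_partialD (hf : ContDiff ℝ 2 f) (i : Fin n) : Continuous (partialD i f) :=
  continuous_iff_continuousAt.2 fun _ => (contDiffAt_partialD i hf.contDiffAt).continuousAt

theorem continuous_opL (hb : Continuous b) (hB : Continuous B) (hf : ContDiff ℝ 2 f) :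
    Continuous (opL b B f) := by
  unfold opL
  have h1 := continuous_diffusion hB
  have h2 := fun i => continuous_partialD hf i
  have h3 : ∀ i j, Continuous (partialD i (partialD j f)) := fun i j =>
    continuous_iff_continuousAt.2 fun y =>
      ((contDiffAt_partialD j hf.contDiffAt).fderiv_right (m := 0) (by norm_num)
        |>.clm_apply contDiffAt_const).continuousAt
  have h4 : ∀ i, Continuous fun y => b y i := fun i => by fun_prop
  fun_prop

end Operator

/-- Uniform ellipticity: the form is continuous and positive on the compact set K × unit sphere, and
homogeneity does the rest. -/
theorem exists_quadA_lower_bound {n m : ℕ} {B : EuclideanSpace ℝ (Fin n) → Matrix (Fin n) (Fin m) ℝ}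
    (hB : Continuous B) (hBr : ∀ y, (B y).rank = n)
    {K : Set (EuclideanSpace ℝ (Fin n))} (hK : IsCompact K) :
    ∃ c > 0, ∀ y ∈ K, ∀ ξ : EuclideanSpace ℝ (Fin n),
      c * ‖ξ‖ ^ 2 ≤ quadA B y (fun i => ξ i) := by
  have hS := hK.prod (isCompact_sphere (0 : EuclideanSpace ℝ (Fin n)) 1)
  have hc : Continuous fun p : EuclideanSpace ℝ (Fin n) × EuclideanSpace ℝ (Fin n) =>
      quadA B p.1 (fun i => p.2 i) := by
    unfold quadA
    have := fun i j => continuous_diffusion hB i j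
    fun_prop
  have hpos : ∀ p ∈ K ×ˢ Metric.sphere (0 : EuclideanSpace ℝ (Fin n)) 1,
      0 < quadA B p.1 (fun i => p.2 i) := by
    rintro ⟨y, ξ⟩ ⟨-, hξ⟩
    refine quadA_pos B (hBr y) fun h0 => ?_
    have : ξ = 0 := by ext i; exact congrFun h0 i
    simp [this] at hξ
  obtain ⟨c, hc0, hcb⟩ := hS.exists_forall_le' hc.continuousOn hpos
  refine ⟨c, hc0, fun y hy ξ => ?_⟩
  rcases eq_or_ne ξ 0 with rfl | hξ
  · simpa using quadA_nonneg B _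
  have hn : ‖ξ‖ ≠ 0 := norm_ne_zero_iff.2 hξ
  have h1 : c ≤ quadA B y (fun i => ‖ξ‖⁻¹ * ξ i) :=
    hcb (y, ‖ξ‖⁻¹ • ξ) ⟨hy, by simp [norm_smul, hn]⟩
  rw [quadA_smul] at h1
  have h2 := mul_le_mul_of_nonneg_left h1 (sq_nonneg ‖ξ‖)
  calc c * ‖ξ‖ ^ 2 = ‖ξ‖ ^ 2 * c := by ring
    _ ≤ ‖ξ‖ ^ 2 * (‖ξ‖⁻¹ ^ 2 * quadA B y (fun i => ξ i)) := h2
    _ = quadA B y (fun i => ξ i) := by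
      rw [← mul_assoc, ← mul_pow, mul_inv_cancel₀ hn, one_pow, one_mul]

/-! ### Strict supersolutions and the weak maximum principle -/

section MaximumPrinciple

variable {n m : ℕ} {b : EuclideanSpace ℝ (Fin n) → EuclideanSpace ℝ (Fin n)}
  {B : EuclideanSpace ℝ (Fin n) → Matrix (Fin n) (Fin m) ℝ}

theorem fderiv_apply_eq_sum (f : EuclideanSpace ℝ (Fin n) → ℝ) (y ξ : EuclideanSpace ℝ (Fin n)) :
    fderiv ℝ f y ξ = ∑ i, ξ i * partialD i f y := by
  have h : ξ = ∑ i, ξ i • EuclideanSpace.single i (1 : ℝ) := by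
    ext j
    simp [Finset.sum_apply, Pi.single_apply]
  conv_lhs => rw [h]
  simp [partialD]

theorem second_deriv_nonneg_of_isLocalMin {v : EuclideanSpace ℝ (Fin n) → ℝ}
    {y : EuclideanSpace ℝ (Fin n)} (hv : ContDiffAt ℝ 2 v y) (hmin : IsLocalMin v y)
    (ξ : EuclideanSpace ℝ (Fin n)) :
    0 ≤ ∑ j, ξ j * ∑ i, ξ i * partialD i (partialD j v) y := by
  set γ : ℝ → ℝ := fun t => v (y + t • ξ) with hγ
  have hline : ∀ t : ℝ, HasDerivAt (fun t : ℝ => y + t • ξ) ξ t := fun t => by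
    simpa using ((hasDerivAt_id t).smul_const ξ).const_add y
  have hcont : Tendsto (fun t : ℝ => y + t • ξ) (𝓝 0) (𝓝 y) := by
    have := (hline 0).continuousAt.tendsto
    simpa using this
  have hd : deriv γ =ᶠ[𝓝 0] fun t => ∑ j, ξ j * partialD j v (y + t • ξ) := by
    filter_upwards [hcont.eventually (eventually_differentiableAt hv)] with t ht
    rw [← fderiv_apply_eq_sum]
    exact (ht.hasFDerivAt.comp_hasDerivAt t (hline t)).deriv
  have hdd : deriv (deriv γ) 0 = ∑ j, ξ j * ∑ i, ξ i * partialD i (partialD j v) y := by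
    rw [hd.deriv_eq]
    refine HasDerivAt.deriv (HasDerivAt.fun_sum fun j _ => HasDerivAt.const_mul _ ?_)
    rw [← fderiv_apply_eq_sum]
    have h1 : HasFDerivAt (partialD j v) (fderiv ℝ (partialD j v) y) (y + (0 : ℝ) • ξ) := by
      simpa using ((contDiffAt_partialD j hv).differentiableAt (by norm_num)).hasFDerivAt
    exact h1.comp_hasDerivAt 0 (hline 0)
  rw [← hdd]
  by_contra! hneg
  have hγmin : IsLocalMin γ 0 := by
    have := hcont.eventually hmin
    simpa [IsLocalMin, IsMinFilter, hγ] using this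
  have hγc : ContinuousAt γ 0 := by
    have h1 : ContinuousAt v (y + (0 : ℝ) • ξ) := by simpa using hv.continuousAt
    exact ContinuousAt.comp (f := fun t : ℝ => y + t • ξ) h1 (hline 0).continuousAt
  -- A negative second derivative would make the local minimum a local maximum as well. The
  -- restriction to the line would then be locally constant, with second derivative zero.
  have hγmax := isLocalMax_of_deriv_deriv_neg hneg hγmin.deriv_eq_zero hγc
  have hconst : γ =ᶠ[𝓝 0] fun _ => γ 0 := by
    filter_upwards [hγmin, hγmax] with t h1 h2
    exact le_antisymm h2 h1
  have : deriv (deriv γ) 0 = 0 := by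
    rw [hconst.deriv.deriv_eq]
    simp
  linarith

/-- Since A is half the sum of the squares (outer products) of the columns of B, the second-order
part is half the sum of second derivatives of v along those columns. No diagonalization is needed.
-/
theorem opL_nonpos_of_isLocalMin {v : EuclideanSpace ℝ (Fin n) → ℝ}
    {y : EuclideanSpace ℝ (Fin n)} (hv : ContDiffAt ℝ 2 v y) (hmin : IsLocalMin v y) :
    opL b B v y ≤ 0 := by
  have h1 : ∀ i, partialD i v y = 0 := fun i => by simp [partialD, hmin.fderiv_eq_zero]
  have h2 : ∑ i, ∑ j, diffusion B y i j * partialD i (partialD j v) y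
      = ∑ k, (1 / 2) * ∑ j, B y j k * ∑ i, B y i k * partialD i (partialD j v) y := by
    simp only [diffusion, Finset.mul_sum, Finset.sum_mul]
    rw [Finset.sum_congr rfl fun i _ => Finset.sum_comm, Finset.sum_comm]
    refine Finset.sum_congr rfl fun k _ => ?_
    rw [Finset.sum_comm]
    exact Finset.sum_congr rfl fun j _ => Finset.sum_congr rfl fun i _ => by ring
  have h3 : 0 ≤ ∑ i, ∑ j, diffusion B y i j * partialD i (partialD j v) y := by
    rw [h2]
    refine Finset.sum_nonneg fun k _ => mul_nonneg (by norm_num) ?_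
    exact second_deriv_nonneg_of_isLocalMin hv hmin (WithLp.toLp 2 fun i => B y i k)
  simp only [opL, h1, mul_zero, Finset.sum_const_zero, add_zero]
  linarith

theorem contDiff_norm_sub_sq (y₀ : EuclideanSpace ℝ (Fin n)) :
    ContDiff ℝ 2 fun y : EuclideanSpace ℝ (Fin n) => ‖y - y₀‖ ^ 2 :=
  (contDiff_id.sub contDiff_const).norm_sq ℝ

theorem partialD_norm_sub_sq (y₀ y : EuclideanSpace ℝ (Fin n)) (i : Fin n) :
    partialD i (fun y : EuclideanSpace ℝ (Fin n) => ‖y - y₀‖ ^ 2) y = 2 * (y - y₀) i := by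
  have h := ((hasFDerivAt_id y).sub_const y₀).norm_sq
  simp only [id] at h
  rw [partialD, h.fderiv]
  simp [EuclideanSpace.inner_single_right]

/-- With w = ‖· - y₀‖², the chain rule gives l·exp(-l w)·(Lw + 4l·(y - y₀)ᵀA(y - y₀)). Away from y₀
the quadratic term is bounded below, so a large l beats the bounded Lw. This serves both the maximum
principle (y₀ far away) and the barriers (y₀ the centre of an exterior ball). -/
theorem exists_opL_neg_exp_pos (hb : Continuous b) (hB : Continuous B)
    (hBr : ∀ y, (B y).rank = n) {K : Set (EuclideanSpace ℝ (Fin n))} (hK : IsCompact K)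
    {y₀ : EuclideanSpace ℝ (Fin n)} {R : ℝ} (hR : 0 < R) (hKR : ∀ y ∈ K, R ≤ ‖y - y₀‖) :
    ∃ l > 0, ∀ y ∈ K, 0 < opL b B (fun z => -Real.exp (-l * ‖z - y₀‖ ^ 2)) y := by
  obtain ⟨c, hc, hcQ⟩ := exists_quadA_lower_bound hB hBr hK
  set w : EuclideanSpace ℝ (Fin n) → ℝ := fun y => ‖y - y₀‖ ^ 2 with hw
  have hwC : ContDiff ℝ 2 w := contDiff_norm_sub_sq y₀
  obtain ⟨M, hM⟩ := hK.exists_bound_of_continuousOn (continuous_opL hb hB hwC).continuousOn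
  -- Chosen so that 4l·cR² = |M| + 1 strictly exceeds the bound on |Lw|.
  set l : ℝ := (|M| + 1) / (4 * (c * R ^ 2)) with hl
  have hlpos : 0 < l := by positivity
  refine ⟨l, hlpos, fun y hy => ?_⟩
  have d1 : ∀ t, HasDerivAt (fun t => -Real.exp (-l * t)) (l * Real.exp (-l * t)) t := fun t =>
    (((hasDerivAt_id t).const_mul (-l)).exp).neg.congr_deriv (by simp only [id]; ring)
  have d2 : ∀ t, HasDerivAt (fun t => l * Real.exp (-l * t)) (-l ^ 2 * Real.exp (-l * t)) t :=
    fun t => (((hasDerivAt_id t).const_mul (-l)).exp).const_mul l |>.congr_deriv (by simp only [id]; ring)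
  rw [opL_comp b B (w := w) d1 d2 hwC.contDiffAt]
  have hQ : quadA B y (fun i => partialD i w y) = 2 ^ 2 * quadA B y (fun i => (y - y₀) i) := by
    rw [← quadA_smul]
    simp only [hw, partialD_norm_sub_sq]
  rw [hQ]
  have h1 := hcQ y hy (y - y₀)
  have h2 : c * R ^ 2 ≤ c * ‖y - y₀‖ ^ 2 := by
    have := hKR y hy
    gcongr
  have h3 : -|M| ≤ opL b B w y := by
    have := (abs_le.1 ((hM y hy).trans (le_abs_self M))).1
    exact this
  have h4 : l * (4 * (c * R ^ 2)) = |M| + 1 := by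
    rw [hl]; field_simp
  have h5 : l * (4 * (c * R ^ 2)) ≤ l * (4 * quadA B y (fun i => (y - y₀) i)) := by
    gcongr; linarith
  have h6 : 0 < l * Real.exp (-l * w y) := by positivity
  calc (0 : ℝ) < (l * Real.exp (-l * w y)) *
        (opL b B w y + l * (4 * quadA B y (fun i => (y - y₀) i))) :=
        mul_pos h6 (by linarith)
    _ = _ := by ring

theorem exists_strict_supersolution (hn : 0 < n) (hb : Continuous b) (hB : Continuous B)
    (hBr : ∀ y, (B y).rank = n) {K : Set (EuclideanSpace ℝ (Fin n))} (hK : IsCompact K) :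
    ∃ ψ : EuclideanSpace ℝ (Fin n) → ℝ, ContDiff ℝ 2 ψ ∧
      ∀ y ∈ K, 1 ≤ opL b B ψ y ∧ 1 ≤ ψ y := by
  -- Positive dimension is what provides a point y₀ of prescribed norm outside a ball containing K.
  have : Nonempty (Fin n) := ⟨⟨0, hn⟩⟩
  obtain ⟨r, hr⟩ := hK.isBounded.subset_closedBall (0 : EuclideanSpace ℝ (Fin n))
  obtain ⟨y₀, hy₀⟩ := exists_norm_eq (EuclideanSpace ℝ (Fin n)) (c := |r| + 1) (by positivity)
  have hKR : ∀ y ∈ K, (1 : ℝ) ≤ ‖y - y₀‖ := fun y hy => by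
    have h1 : ‖y‖ ≤ r := by simpa using hr hy
    have h2 := norm_sub_norm_le y₀ y
    rw [norm_sub_rev] at h2
    have := le_abs_self r
    linarith
  obtain ⟨l, hl, hL⟩ := exists_opL_neg_exp_pos hb hB hBr hK one_pos hKR
  set φ : EuclideanSpace ℝ (Fin n) → ℝ := fun z => -Real.exp (-l * ‖z - y₀‖ ^ 2) with hφ
  have hφC : ContDiff ℝ 2 φ := (contDiff_const.mul (contDiff_norm_sub_sq y₀)).exp.neg
  obtain ⟨c, hc, hcL⟩ := hK.exists_forall_le' (continuous_opL hb hB hφC).continuousOn hL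
  obtain ⟨M, hM⟩ := hK.exists_bound_of_continuousOn
    (contDiff_const.mul hφC : ContDiff ℝ 2 fun z => c⁻¹ * φ z).continuous.continuousOn
  refine ⟨fun z => c⁻¹ * φ z + (M + 1), (contDiff_const.mul hφC).add contDiff_const,
    fun y hy => ⟨?_, ?_⟩⟩
  · rw [opL_add b B (contDiff_const.mul hφC).contDiffAt contDiffAt_const, opL_const,
      opL_const_mul b B _ hφC.contDiffAt, add_zero]
    calc (1 : ℝ) = c⁻¹ * c := (inv_mul_cancel₀ hc.ne').symm
      _ ≤ _ := by
        have := hcL y hy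
        gcongr
  · have := (abs_le.1 (hM y hy)).1
    linarith

theorem nonneg_of_opL_nonneg (hn : 0 < n) (hb : Continuous b) (hB : Continuous B)
    (hBr : ∀ y, (B y).rank = n) {X : Set (EuclideanSpace ℝ (Fin n))} (hXo : IsOpen X)
    (hXb : Bornology.IsBounded X) {v : EuclideanSpace ℝ (Fin n) → ℝ} (hv : ContDiff ℝ 2 v)
    (hLv : ∀ y ∈ X, 0 ≤ opL b B v y) (hv0 : ∀ y ∈ frontier X, 0 ≤ v y)
    {x : EuclideanSpace ℝ (Fin n)} (hx : x ∈ X) : 0 ≤ v x := by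
  have hK : IsCompact (closure X) := hXb.isCompact_closure
  obtain ⟨ψ, hψ, hψ1⟩ := exists_strict_supersolution (b := b) hn hb hB hBr hK
  by_contra! hneg
  have hψx : 0 < ψ x := by linarith [(hψ1 x (subset_closure hx)).2]
  -- With this ε the perturbed function v + εψ equals v(x)/2 < 0 at x, so its minimum is negative
  -- and, by the boundary condition, interior. There Lv + εLψ > 0 contradicts minimality.
  set ε : ℝ := -v x / (2 * ψ x) with hε
  have hεpos : 0 < ε := div_pos (by linarith) (by linarith)
  have hεx : ε * ψ x = -v x / 2 := by rw [hε]; field_simp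
  have hu : ContDiff ℝ 2 fun z => v z + ε * ψ z := hv.add (contDiff_const.mul hψ)
  obtain ⟨y, hyK, hymin⟩ := hK.exists_isMinOn ⟨x, subset_closure hx⟩ hu.continuous.continuousOn
  have hyx : v y + ε * ψ y ≤ v x + ε * ψ x := hymin (subset_closure hx)
  have hyX : y ∈ X := by
    by_contra hyX
    have h1 : y ∈ frontier X := by rw [hXo.frontier_eq]; exact ⟨hyK, hyX⟩
    have h2 := hv0 y h1
    have h3 : 0 < ε * ψ y := mul_pos hεpos (by linarith [(hψ1 y hyK).2])
    linarith
  have hloc : IsLocalMin (fun z => v z + ε * ψ z) y :=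
    (hymin.on_subset subset_closure).isLocalMin (hXo.mem_nhds hyX)
  have h1 := opL_nonpos_of_isLocalMin (b := b) (B := B) hu.contDiffAt hloc
  rw [opL_add b B hv.contDiffAt (contDiff_const.mul hψ).contDiffAt,
    opL_const_mul b B _ hψ.contDiffAt] at h1
  have h2 := hLv y hyX
  have h3 : 0 < ε * opL b B ψ y := mul_pos hεpos (by linarith [(hψ1 y hyK).1])
  linarith

end MaximumPrinciple

/-- Riesz representation on the compact space S, pushed forward to the ambient space by the
inclusion. -/
theorem exists_measure_of_positive_functional {α : Type*} [TopologicalSpace α] [T2Space α]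
    [MeasurableSpace α] [BorelSpace α] {S : Set α} (hS : IsCompact S) (Λ : C(S, ℝ) →ₗ[ℝ] ℝ)
    (hΛ : ∀ h : C(S, ℝ), (∀ y, 0 ≤ h y) → 0 ≤ Λ h) :
    ∃ μ : Measure α, IsFiniteMeasure μ ∧ μ Sᶜ = 0 ∧
      ∀ (f : α → ℝ) (hf : ContinuousOn f S), ∫ y, f y ∂μ = Λ ⟨S.domRestrict f, hf.domRestrict⟩ := by
  have : CompactSpace S := isCompact_iff_compactSpace.1 hS
  let Λ₀ : CompactlySupportedContinuousMap S ℝ →ₗ[ℝ] ℝ :=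
    { toFun := fun f => Λ f.toContinuousMap
      map_add' := fun f h => Λ.map_add f.toContinuousMap h.toContinuousMap
      map_smul' := fun c f => Λ.map_smul c f.toContinuousMap }
  let Λ' : CompactlySupportedContinuousMap S ℝ →ₚ[ℝ] ℝ :=
    PositiveLinearMap.mk₀ Λ₀ fun f hf => hΛ _ fun y => hf y
  have hemb := MeasurableEmbedding.subtype_coe hS.measurableSet
  refine ⟨(RealRMK.rieszMeasure Λ').map (Subtype.val), ?_, ?_, fun f hf => ?_⟩
  · infer_instance
  · rw [hemb.map_apply]
    simp
  · rw [hemb.integral_map]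
    exact RealRMK.integral_rieszMeasure Λ'
      (⟨⟨S.domRestrict f, hf.domRestrict⟩, HasCompactSupport.of_compactSpace _⟩ :
        CompactlySupportedContinuousMap S ℝ)

/-! ### Strong duality by Hahn-Banach -/

section Duality

variable {n m : ℕ}

/-- The values at `x` of the `C²` functions `v` with `L v ≥ h` on `closure X` and `v ≥ k` on
`∂X`. -/
def perturbedValues (X : Set (EuclideanSpace ℝ (Fin n)))
    (b : EuclideanSpace ℝ (Fin n) → EuclideanSpace ℝ (Fin n))
    (B : EuclideanSpace ℝ (Fin n) → Matrix (Fin n) (Fin m) ℝ) (x : EuclideanSpace ℝ (Fin n))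
    (e : C(closure X, ℝ) × C(frontier X, ℝ)) : Set ℝ :=
  {c | ∃ v : EuclideanSpace ℝ (Fin n) → ℝ, ContDiff ℝ 2 v ∧
    (∀ y : closure X, e.1 y ≤ opL b B v y) ∧ (∀ y : frontier X, e.2 y ≤ v y) ∧ c = v x}

variable {X : Set (EuclideanSpace ℝ (Fin n))}
  {b : EuclideanSpace ℝ (Fin n) → EuclideanSpace ℝ (Fin n)}
  {B : EuclideanSpace ℝ (Fin n) → Matrix (Fin n) (Fin m) ℝ} {x : EuclideanSpace ℝ (Fin n)}

theorem mul_mem_perturbedValues {e : C(closure X, ℝ) × C(frontier X, ℝ)} {a c : ℝ} (hc : 0 ≤ c)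
    (ha : a ∈ perturbedValues X b B x e) : c * a ∈ perturbedValues X b B x (c • e) := by
  obtain ⟨v, hv, h1, h2, rfl⟩ := ha
  refine ⟨fun z => c * v z, contDiff_const.mul hv, fun y => ?_, fun y => ?_, rfl⟩
  · rw [opL_const_mul b B c hv.contDiffAt]
    exact mul_le_mul_of_nonneg_left (h1 y) hc
  · exact mul_le_mul_of_nonneg_left (h2 y) hc

theorem add_mem_perturbedValues {e e' : C(closure X, ℝ) × C(frontier X, ℝ)} {a a' : ℝ}
    (ha : a ∈ perturbedValues X b B x e) (ha' : a' ∈ perturbedValues X b B x e') :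
    a + a' ∈ perturbedValues X b B x (e + e') := by
  obtain ⟨v, hv, h1, h2, rfl⟩ := ha
  obtain ⟨v', hv', h1', h2', rfl⟩ := ha'
  refine ⟨fun z => v z + v' z, hv.add hv', fun y => ?_, fun y => ?_, rfl⟩
  · rw [opL_add b B hv.contDiffAt hv'.contDiffAt]
    exact add_le_add (h1 y) (h1' y)
  · exact add_le_add (h2 y) (h2' y)

variable (hn : 0 < n) (hXo : IsOpen X) (hXb : Bornology.IsBounded X) (hb : Continuous b)
  (hB : Continuous B) (hBr : ∀ y, (B y).rank = n) (hx : x ∈ X)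

include hn hXb hb hB hBr

/-- The multiple ‖e‖ψ of a strict supersolution with Lψ ≥ 1 and ψ ≥ 1 meets both constraints. -/
theorem perturbedValues_nonempty (e : C(closure X, ℝ) × C(frontier X, ℝ)) :
    (perturbedValues X b B x e).Nonempty := by
  have hK : IsCompact (closure X) := hXb.isCompact_closure
  have : CompactSpace (closure X) := isCompact_iff_compactSpace.1 hK
  have : CompactSpace (frontier X) :=
    isCompact_iff_compactSpace.1 (hK.of_isClosed_subset isClosed_frontier frontier_subset_closure)
  obtain ⟨ψ, hψ, hψ1⟩ := exists_strict_supersolution (b := b) hn hb hB hBr hK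
  have hM : 0 ≤ ‖e‖ := norm_nonneg e
  refine ⟨_, fun z => ‖e‖ * ψ z, contDiff_const.mul hψ, fun y => ?_, fun y => ?_, rfl⟩
  · rw [opL_const_mul b B _ hψ.contDiffAt]
    calc e.1 y ≤ ‖e.1‖ := (le_abs_self _).trans (e.1.norm_coe_le_norm y)
      _ ≤ ‖e‖ * 1 := by rw [mul_one]; exact norm_fst_le e
      _ ≤ _ := mul_le_mul_of_nonneg_left (hψ1 y y.2).1 hM
  · calc e.2 y ≤ ‖e.2‖ := (le_abs_self _).trans (e.2.norm_coe_le_norm y)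
      _ ≤ ‖e‖ * 1 := by rw [mul_one]; exact norm_snd_le e
      _ ≤ _ := mul_le_mul_of_nonneg_left (hψ1 y (frontier_subset_closure y.2)).2 hM

include hXo hx

/-- Adding a fixed competitor for -e to any competitor for e gives one for zero data, which is
nonnegative at x by the maximum principle. -/
theorem perturbedValues_bddBelow (e : C(closure X, ℝ) × C(frontier X, ℝ)) :
    BddBelow (perturbedValues X b B x e) := by
  obtain ⟨a, ha⟩ := perturbedValues_nonempty (x := x) hn hXb hb hB hBr (-e)
  refine ⟨-a, fun c hc => ?_⟩
  obtain ⟨v, hv, h1, h2, h3⟩ := add_mem_perturbedValues hc ha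
  rw [add_neg_cancel] at h1 h2
  have := nonneg_of_opL_nonneg hn hb hB hBr hXo hXb hv
    (fun y hy => h1 ⟨y, subset_closure hy⟩) (fun y hy => h2 ⟨y, hy⟩) hx
  linarith

/-- The infimum p is finite, positively homogeneous and subadditive, so Hahn-Banach extends c·(0, k)
↦ c·p(0, k) from a line to a functional dominated by p. -/
theorem exists_functional_of_perturbedValues (k : C(frontier X, ℝ)) :
    ∃ Λ : C(closure X, ℝ) × C(frontier X, ℝ) →ₗ[ℝ] ℝ,
      Λ (0, k) = sInf (perturbedValues X b B x (0, k)) ∧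
      ∀ e, ∀ a ∈ perturbedValues X b B x e, Λ e ≤ a := by
  set p : C(closure X, ℝ) × C(frontier X, ℝ) → ℝ := fun e => sInf (perturbedValues X b B x e)
    with hp
  have hne := perturbedValues_nonempty (x := x) hn hXb hb hB hBr
  have hbd := perturbedValues_bddBelow hn hXo hXb hb hB hBr hx
  have hsmul_le : ∀ c : ℝ, 0 < c → ∀ e, p (c • e) ≤ c * p e := fun c hc e => by
    rw [← div_le_iff₀' hc]
    refine le_csInf (hne e) fun a ha => ?_
    rw [div_le_iff₀' hc]
    exact csInf_le (hbd _) (mul_mem_perturbedValues hc.le ha)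
  have hsmul : ∀ c : ℝ, 0 < c → ∀ e, p (c • e) = c * p e := fun c hc e => by
    refine le_antisymm (hsmul_le c hc e) ?_
    have h1 := hsmul_le c⁻¹ (inv_pos.2 hc) (c • e)
    rw [inv_smul_smul₀ hc.ne'] at h1
    rwa [← le_inv_mul_iff₀ hc]
  have hadd : ∀ e e', p (e + e') ≤ p e + p e' := fun e e' => by
    have h1 : ∀ a ∈ perturbedValues X b B x e, p (e + e') - a ≤ p e' := fun a ha => by
      refine le_csInf (hne e') fun a' ha' => ?_
      have := csInf_le (hbd _) (add_mem_perturbedValues ha ha')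
      simp only [hp]
      linarith
    have h2 : p (e + e') - p e' ≤ p e := le_csInf (hne e) fun a ha => by
      have := h1 a ha
      linarith
    linarith
  have hzero : p 0 = 0 := by
    have := hsmul 2 two_pos 0
    rw [smul_zero] at this
    linarith
  -- Well-definedness on the span: the degenerate case is k = 0, where p vanishes.
  have H : ∀ c : ℝ, c • ((0, k) : C(closure X, ℝ) × C(frontier X, ℝ)) = 0 →
      RingHom.id ℝ c • p (0, k) = 0 := fun c hc => by
    rcases eq_or_ne c 0 with rfl | hc0
    · simp
    · rw [(smul_eq_zero.1 hc).resolve_left hc0, hzero, smul_zero]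
  obtain ⟨Λ, hΛ1, hΛ2⟩ := exists_extension_of_le_sublinear
    (LinearPMap.mkSpanSingleton' ((0, k) : C(closure X, ℝ) × C(frontier X, ℝ)) (p (0, k)) H) p
    hsmul hadd (by
      rintro ⟨e, he⟩
      obtain ⟨c, rfl⟩ := Submodule.mem_span_singleton.1 he
      rw [LinearPMap.mkSpanSingleton'_apply]
      change c * p (0, k) ≤ p (c • (0, k))
      -- For c < 0, domination on the line follows from 0 = p(0) ≤ p(c·(0, k)) + p(-c·(0, k)).
      rcases lt_trichotomy c 0 with hc | rfl | hc
      · have h1 := hadd (c • (0, k)) ((-c) • (0, k))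
        rw [hsmul (-c) (by linarith), ← add_smul, add_neg_cancel, zero_smul, hzero] at h1
        linarith
      · simp [hzero]
      · exact (hsmul c hc _).ge)
  refine ⟨Λ, ?_, fun e a ha => (hΛ2 e).trans (csInf_le (hbd e) ha)⟩
  have hmem := Submodule.mem_span_singleton_self (R := ℝ)
    ((0, k) : C(closure X, ℝ) × C(frontier X, ℝ))
  have := hΛ1 ⟨(0, k), hmem⟩
  exact this.trans (LinearPMap.mkSpanSingleton'_apply_self _ _ H hmem)

/-- Up to mass of `μ` on the boundary, the dual value is attained by a pair of measures. -/
theorem exists_kolmogorov_pair_closure {g : EuclideanSpace ℝ (Fin n) → ℝ}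
    (hg : ContinuousOn g (frontier X)) :
    ∃ μ ν : Measure (EuclideanSpace ℝ (Fin n)), IsFiniteMeasure μ ∧ IsFiniteMeasure ν ∧
      μ (closure X)ᶜ = 0 ∧ ν (frontier X)ᶜ = 0 ∧ Kolmogorov b B x μ ν ∧
      IsGLB {c | ∃ v, ContDiff ℝ 2 v ∧ IsSuper X b B g v ∧ c = v x} (∫ y, g y ∂ν) := by
  have hK : IsCompact (closure X) := hXb.isCompact_closure
  have hF : IsCompact (frontier X) :=
    hK.of_isClosed_subset isClosed_frontier frontier_subset_closure
  set k : C(frontier X, ℝ) := ⟨(frontier X).domRestrict g, hg.domRestrict⟩ with hk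
  obtain ⟨Λ, hΛk, hΛ⟩ := exists_functional_of_perturbedValues hn hXo hXb hb hB hBr hx k
  -- The zero function is a competitor for nonpositive data, so Λ is nonpositive there, which is
  -- positivity of Λ.
  have hzero : ∀ e : C(closure X, ℝ) × C(frontier X, ℝ), (∀ y, e.1 y ≤ 0) → (∀ y, e.2 y ≤ 0) →
      Λ e ≤ 0 := fun e h1 h2 => by
    refine hΛ e 0 ⟨fun _ => 0, contDiff_const, fun y => ?_, h2, rfl⟩
    rw [opL_const]
    exact h1 y
  obtain ⟨μ, hμ, hμK, hμi⟩ := exists_measure_of_positive_functional hK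
    (Λ ∘ₗ LinearMap.inl ℝ _ _) fun h hh => by
      have := hzero (-(h, 0)) (fun y => by simpa using hh y) (fun y => by simp)
      rw [map_neg] at this
      simpa using this
  obtain ⟨ν, hν, hνF, hνi⟩ := exists_measure_of_positive_functional hF
    (Λ ∘ₗ LinearMap.inr ℝ _ _) fun h hh => by
      have := hzero (-(0, h)) (fun y => by simp) (fun y => by simpa using hh y)
      rw [map_neg] at this
      simpa using this
  refine ⟨μ, ν, hμ, hν, hμK, hνF, fun f hf => ?_, ?_⟩
  · have hLf := continuous_opL hb hB hf
    rw [hνi f hf.continuous.continuousOn, hμi _ hLf.continuousOn]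
    simp only [LinearMap.comp_apply, LinearMap.inl_apply, LinearMap.inr_apply]
    rw [← map_add]
    simp only [Prod.mk_add_mk, zero_add, add_zero]
    refine le_antisymm ?_ ?_
    · exact hΛ _ _ ⟨f, hf, fun y => le_rfl, fun y => le_rfl, rfl⟩
    · have := hΛ (-(⟨(closure X).domRestrict (opL b B f), hLf.continuousOn.domRestrict⟩,
        ⟨(frontier X).domRestrict f, hf.continuous.continuousOn.domRestrict⟩)) (-f x)
        ⟨fun z => -f z, hf.neg, fun y => by rw [opL_neg b B hf.contDiffAt]; rfl,
          fun y => le_rfl, rfl⟩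
      rw [map_neg] at this
      linarith
  · rw [hνi g hg]
    simp only [LinearMap.comp_apply, LinearMap.inr_apply]
    rw [hΛk]
    -- The perturbed problem imposes Lv ≥ 0 on the closure. For globally C² functions Lv is
    -- continuous, so this is the same as imposing it on X.
    have hset : {c | ∃ v, ContDiff ℝ 2 v ∧ IsSuper X b B g v ∧ c = v x}
        = perturbedValues X b B x (0, k) := by
      ext c
      refine exists_congr fun v => and_congr_right fun hv => ?_
      rw [IsSuper, and_assoc]
      refine and_congr ⟨fun h y => ?_, fun h y hy => h ⟨y, subset_closure hy⟩⟩
        (and_congr ⟨fun h y => h y y.2, fun h y hy => h ⟨y, hy⟩⟩ Iff.rfl)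
      exact closure_minimal (fun z hz => h z hz)
        (isClosed_le continuous_const (continuous_opL hb hB hv)) y.2
    rw [hset]
    exact isGLB_csInf (perturbedValues_nonempty hn hXb hb hB hBr _)
      (perturbedValues_bddBelow hn hXo hXb hb hB hBr hx _)

end Duality

/-! ### No mass of μ on the boundary -/

theorem integrable_of_continuousOn_compact {α : Type*} [TopologicalSpace α] [T2Space α]
    [MeasurableSpace α] [BorelSpace α] {S : Set α} (hS : IsCompact S) {μ : Measure α}
    [IsFiniteMeasure μ] (hμ : μ Sᶜ = 0) {f : α → ℝ} (hf : ContinuousOn f S) : Integrable f μ := by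
  have h1 : IntegrableOn f S μ := hf.integrableOn_compact hS
  rwa [IntegrableOn, Measure.restrict_eq_self_of_ae_mem (mem_ae_iff.2 hμ)] at h1

/-- Cutting off the local defining function by a bump makes it globally C², hence usable in test
functions. It is nonpositive on the closure of X near z by continuity, and nonnegative at nearby
frontier points because these lie outside the open set X. -/
theorem exists_defining_function {n : ℕ} {X : Set (EuclideanSpace ℝ (Fin n))} (hXo : IsOpen X)
    (hXs : HasSmoothBoundary X) {z : EuclideanSpace ℝ (Fin n)} (hz : z ∈ frontier X) :
    ∃ w : EuclideanSpace ℝ (Fin n) → ℝ, ContDiff ℝ 2 w ∧ fderiv ℝ w z ≠ 0 ∧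
      ∀ᶠ y in 𝓝 z, (y ∈ closure X → w y ≤ 0) ∧ (y ∈ frontier X → w y = 0) := by
  obtain ⟨U, ρ, hU, hzU, hρ, hdρ, hXU⟩ := hXs z hz
  obtain ⟨r, hr, hrU⟩ := Metric.isOpen_iff.1 hU z hzU
  let χ : ContDiffBump z := ⟨r / 4, r / 2, by positivity, by linarith⟩
  have hχρ : (fun y => χ y * ρ y) =ᶠ[𝓝 z] ρ := by
    filter_upwards [χ.eventuallyEq_one] with y hy
    simp [hy]
  have hle : ∀ y ∈ U, y ∈ closure X → ρ y ≤ 0 := fun y hyU hy => by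
    have hρc : ContinuousAt ρ y := (hρ.contDiffAt (hU.mem_nhds hyU)).continuousAt
    by_contra! hpos
    have h1 : ∀ᶠ y' in 𝓝 y, 0 < ρ y' ∧ y' ∈ U :=
      (hρc.eventually (lt_mem_nhds hpos)).and (hU.mem_nhds hyU)
    obtain ⟨y', hy'X, hy'⟩ := (mem_closure_iff_frequently.1 hy |>.and_eventually h1).exists
    have : y' ∈ X ∩ U := ⟨hy'X, hy'.2⟩
    rw [hXU] at this
    exact lt_asymm this.2 hy'.1
  have hge : ∀ y ∈ U, y ∈ frontier X → 0 ≤ ρ y := fun y hyU hy => by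
    by_contra! hneg
    have : y ∈ X ∩ U := by rw [hXU]; exact ⟨hyU, hneg⟩
    rw [hXo.frontier_eq] at hy
    exact hy.2 this.1
  refine ⟨fun y => χ y * ρ y, contDiff_iff_contDiffAt.2 fun y => ?_, ?_, ?_⟩
  · by_cases hy : y ∈ U
    · exact χ.contDiff.contDiffAt.mul ((hρ.contDiffAt (hU.mem_nhds hy)).of_le (mod_cast le_top))
    · have h1 : y ∉ tsupport χ := fun h => hy (by
        rw [χ.tsupport_eq] at h
        exact hrU (Metric.closedBall_subset_ball (by change r / 2 < r; linarith) h))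
      have h2 : (fun y => χ y * ρ y) =ᶠ[𝓝 y] fun _ => 0 := by
        filter_upwards [notMem_tsupport_iff_eventuallyEq.1 h1] with y' hy'
        simp [hy']
      exact contDiffAt_const.congr_of_eventuallyEq h2
  · rwa [hχρ.fderiv_eq]
  · filter_upwards [hχρ, hU.mem_nhds hzU] with y hy hyU
    rw [hy]
    exact ⟨hle y hyU, fun h => le_antisymm (hle y hyU (frontier_subset_closure h)) (hge y hyU h)⟩

section BoundaryMass

theorem hasDerivAt_sqrt_sq_add {ε : ℝ} (hε : 0 < ε) (t : ℝ) :
    HasDerivAt (fun t => √(ε ^ 2 + t ^ 2)) (t / √(ε ^ 2 + t ^ 2)) t := by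
  have h : 0 < ε ^ 2 + t ^ 2 := by positivity
  refine ((((hasDerivAt_id t).pow 2).const_add (ε ^ 2)).sqrt h.ne').congr_deriv ?_
  simp only [id, Nat.cast_ofNat, Pi.pow_apply, Nat.add_one_sub_one, pow_one]
  field_simp

theorem hasDerivAt_div_sqrt_sq_add {ε : ℝ} (hε : 0 < ε) (t : ℝ) :
    HasDerivAt (fun t => ε * (t / √(ε ^ 2 + t ^ 2))) ((ε / √(ε ^ 2 + t ^ 2)) ^ 3) t := by
  have h : 0 < ε ^ 2 + t ^ 2 := by positivity
  have hs := Real.sqrt_pos.2 h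
  refine (((hasDerivAt_id t).div (hasDerivAt_sqrt_sq_add hε t) hs.ne').const_mul ε).congr_deriv ?_
  have h2 : √(ε ^ 2 + t ^ 2) ^ 2 = ε ^ 2 + t ^ 2 := Real.sq_sqrt h.le
  simp only [id]
  field_simp
  rw [h2]
  ring

theorem tendsto_sqrt_sq_add (t : ℝ) :
    Tendsto (fun ε => √(ε ^ 2 + t ^ 2)) (𝓝[>] 0) (𝓝 |t|) := by
  have h : Continuous fun ε : ℝ => √(ε ^ 2 + t ^ 2) := by fun_prop
  have := (h.tendsto 0).mono_left (nhdsWithin_le_nhds (s := Ioi 0))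
  simpa [Real.sqrt_sq_eq_abs] using this

theorem abs_le_sqrt_sq_add (ε t : ℝ) : |t| ≤ √(ε ^ 2 + t ^ 2) :=
  Real.abs_le_sqrt (by nlinarith [sq_nonneg ε])

theorem le_sqrt_sq_add (ε t : ℝ) : ε ≤ √(ε ^ 2 + t ^ 2) :=
  (le_abs_self ε).trans (Real.abs_le_sqrt (by nlinarith [sq_nonneg t]))

theorem div_sqrt_sq_add_pow_le_one {ε : ℝ} (hε : 0 < ε) (t : ℝ) :
    (ε / √(ε ^ 2 + t ^ 2)) ^ 3 ≤ 1 :=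
  pow_le_one₀ (by positivity) (div_le_one_of_le₀ (le_sqrt_sq_add ε t) (Real.sqrt_nonneg _))

variable {n m : ℕ} {b : EuclideanSpace ℝ (Fin n) → EuclideanSpace ℝ (Fin n)}
  {B : EuclideanSpace ℝ (Fin n) → Matrix (Fin n) (Fin m) ℝ}

/-- Test the constraint with θ(w), where θ(t) = ε√(ε² + t²). As ε → 0, θ and θ' tend to 0, while θ''
stays in [0, 1], equals 1 at t = 0 and tends to 0 elsewhere. Only the quadratic form on {w = 0}
survives in the limit, with zero integral. -/
theorem ae_quadA_eq_zero (hb : Continuous b) (hB : Continuous B)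
    {x : EuclideanSpace ℝ (Fin n)} {μ ν : Measure (EuclideanSpace ℝ (Fin n))} [IsFiniteMeasure μ]
    [IsFiniteMeasure ν] {K F : Set (EuclideanSpace ℝ (Fin n))} (hK : IsCompact K)
    (hF : IsCompact F) (hμ : μ Kᶜ = 0) (hν : ν Fᶜ = 0) (hkol : Kolmogorov b B x μ ν)
    {w : EuclideanSpace ℝ (Fin n) → ℝ} (hw : ContDiff ℝ 2 w) :
    ∀ᵐ y ∂μ, w y = 0 → quadA B y (fun i => partialD i w y) = 0 := by
  set Q : EuclideanSpace ℝ (Fin n) → ℝ := fun y => quadA B y (fun i => partialD i w y) with hQ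
  have hQc : Continuous Q := by
    have h1 := continuous_diffusion hB
    have h2 := continuous_partialD hw
    simp only [hQ, quadA]
    fun_prop
  have hQ0 : ∀ y, 0 ≤ Q y := fun y => quadA_nonneg B _
  have hLc := continuous_opL hb hB hw
  have hwc := hw.continuous
  have hwm : MeasurableSet {y | w y = 0} := measurableSet_eq_fun hwc.measurable measurable_const
  let f : ℝ → EuclideanSpace ℝ (Fin n) → ℝ := fun ε y => ε * √(ε ^ 2 + w y ^ 2)
  have hfC : ∀ ε > 0, ContDiff ℝ 2 (f ε) := fun ε hε =>
    contDiff_const.mul ((contDiff_const.add (hw.pow 2)).sqrt fun y => by positivity)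
  have hLf : ∀ ε > 0, ∀ y, opL b B (f ε) y
      = ε * (w y / √(ε ^ 2 + w y ^ 2)) * opL b B w y - (ε / √(ε ^ 2 + w y ^ 2)) ^ 3 * Q y :=
    fun ε hε y => by
      have h := opL_comp b B (w := w) (θ := fun t => ε * √(ε ^ 2 + t ^ 2))
        (θ' := fun t => ε * (t / √(ε ^ 2 + t ^ 2))) (θ'' := fun t => (ε / √(ε ^ 2 + t ^ 2)) ^ 3)
        (fun t => (hasDerivAt_sqrt_sq_add hε t).const_mul ε)
        (fun t => hasDerivAt_div_sqrt_sq_add hε t) (hw.contDiffAt (x := y))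
      simp only [f, hQ, h]
  have hev : ∀ᶠ ε in 𝓝[>] (0 : ℝ), 0 < ε ∧ ε < 1 := Ioo_mem_nhdsGT one_pos
  have hid : Tendsto (fun ε : ℝ => ε) (𝓝[>] 0) (𝓝 0) := nhdsWithin_le_nhds
  have hfx : ∀ y, Tendsto (fun ε => f ε y) (𝓝[>] 0) (𝓝 0) := fun y => by
    simpa using hid.mul (tendsto_sqrt_sq_add (w y))
  have hfν : Tendsto (fun ε => ∫ y, f ε y ∂ν) (𝓝[>] 0) (𝓝 0) := by
    have := tendsto_integral_filter_of_dominated_convergence (μ := ν) (F := f)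
      (f := fun _ => 0) (fun y => √(1 ^ 2 + w y ^ 2)) (l := 𝓝[>] 0)
      (by
        filter_upwards [hev] with ε hε
        exact (hfC ε hε.1).continuous.aestronglyMeasurable)
      (by
        filter_upwards [hev] with ε hε
        refine .of_forall fun y => ?_
        have h1 : √(ε ^ 2 + w y ^ 2) ≤ √(1 ^ 2 + w y ^ 2) :=
          Real.sqrt_le_sqrt (by nlinarith [hε.1, hε.2])
        rw [Real.norm_of_nonneg (mul_nonneg hε.1.le (Real.sqrt_nonneg _))]
        calc ε * √(ε ^ 2 + w y ^ 2) ≤ 1 * √(1 ^ 2 + w y ^ 2) := by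
              gcongr
              exact hε.2.le
          _ = _ := one_mul _)
      (integrable_of_continuousOn_compact hF hν (by fun_prop))
      (.of_forall hfx)
    simpa using this
  have hfμ : Tendsto (fun ε => ∫ y, opL b B (f ε) y ∂μ) (𝓝[>] 0)
      (𝓝 (∫ y, -({y | w y = 0}.indicator Q y) ∂μ)) := by
    refine tendsto_integral_filter_of_dominated_convergence (fun y => |opL b B w y| + Q y)
      ?_ ?_ (integrable_of_continuousOn_compact hK hμ (by fun_prop)) (.of_forall fun y => ?_)
    · filter_upwards [hev] with ε hε
      exact (continuous_opL hb hB (hfC ε hε.1)).aestronglyMeasurable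
    · filter_upwards [hev] with ε hε
      refine .of_forall fun y => ?_
      rw [hLf ε hε.1]
      have hs : 0 < √(ε ^ 2 + w y ^ 2) := hε.1.trans_le (le_sqrt_sq_add _ _)
      refine (norm_sub_le _ _).trans (add_le_add ?_ ?_)
      · rw [norm_mul, norm_mul, norm_div, Real.norm_eq_abs, Real.norm_eq_abs, Real.norm_eq_abs,
          Real.norm_eq_abs, abs_of_pos hε.1, abs_of_pos hs]
        have h1 : |w y| / √(ε ^ 2 + w y ^ 2) ≤ 1 :=
          div_le_one_of_le₀ (abs_le_sqrt_sq_add _ _) hs.le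
        have h2 : ε * (|w y| / √(ε ^ 2 + w y ^ 2)) ≤ 1 :=
          mul_le_one₀ hε.2.le (by positivity) h1
        exact mul_le_of_le_one_left (abs_nonneg _) h2
      · have h3 : 0 ≤ ε / √(ε ^ 2 + w y ^ 2) := div_nonneg hε.1.le hs.le
        rw [norm_mul, Real.norm_of_nonneg (hQ0 y), Real.norm_of_nonneg (by positivity)]
        exact mul_le_of_le_one_left (hQ0 y) (div_sqrt_sq_add_pow_le_one hε.1 _)
    · have heq : (fun ε => ε * (w y / √(ε ^ 2 + w y ^ 2)) * opL b B w y
          - (ε / √(ε ^ 2 + w y ^ 2)) ^ 3 * Q y) =ᶠ[𝓝[>] 0] fun ε => opL b B (f ε) y := by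
        filter_upwards [hev] with ε hε
        rw [hLf ε hε.1]
      refine Tendsto.congr' heq ?_
      by_cases hy : w y = 0
      · have h1 : ∀ᶠ ε in 𝓝[>] (0 : ℝ), -Q y = ε * (w y / √(ε ^ 2 + w y ^ 2)) * opL b B w y
            - (ε / √(ε ^ 2 + w y ^ 2)) ^ 3 * Q y := by
          filter_upwards [hev] with ε hε
          simp [hy, Real.sqrt_sq hε.1.le, hε.1.ne']
        rw [indicator_of_mem (by exact hy)]
        exact Tendsto.congr' h1 tendsto_const_nhds
      · rw [indicator_of_notMem (by exact hy)]
        have hs := tendsto_sqrt_sq_add (w y)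
        have hne : |w y| ≠ 0 := abs_ne_zero.2 hy
        have h1 := ((hid.mul (tendsto_const_nhds.div hs hne)).mul_const (opL b B w y)).sub
          (((hid.div hs hne).pow 3).mul_const (Q y)) (a := 0 * (w y / |w y|) * opL b B w y)
        simpa using h1
  -- Limit of the identity ∫f dν + ∫Lf dμ = f(x): the ν-term and the right-hand side both vanish.
  have hlim : (0 : ℝ) + ∫ y, -({y | w y = 0}.indicator Q y) ∂μ = 0 := by
    refine tendsto_nhds_unique (hfν.add hfμ) ((hfx x).congr' ?_)
    filter_upwards [hev] with ε hε
    exact (hkol (f ε) (hfC ε hε.1)).symm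
  rw [zero_add, integral_neg, neg_eq_zero, integral_eq_zero_iff_of_nonneg
    (fun y => indicator_nonneg (fun y _ => hQ0 y) y)
    ((integrable_of_continuousOn_compact hK hμ hQc.continuousOn).indicator hwm)] at hlim
  filter_upwards [hlim] with y hy hwy
  rwa [indicator_of_mem (by exact hwy)] at hy

/-- Near each boundary point some partial derivative of the defining function w is nonzero and w
vanishes on ∂X. There the quadratic form of ∇w is positive, so the previous almost-everywhere
statement leaves only a null set. -/
theorem measure_frontier_eq_zero (hb : Continuous b) (hB : Continuous B)
    (hBr : ∀ y, (B y).rank = n) {X : Set (EuclideanSpace ℝ (Fin n))} (hXo : IsOpen X)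
    (hXb : Bornology.IsBounded X) (hXs : HasSmoothBoundary X)
    {x : EuclideanSpace ℝ (Fin n)} {μ ν : Measure (EuclideanSpace ℝ (Fin n))} [IsFiniteMeasure μ]
    [IsFiniteMeasure ν] (hμ : μ (closure X)ᶜ = 0) (hν : ν (frontier X)ᶜ = 0)
    (hkol : Kolmogorov b B x μ ν) : μ (frontier X) = 0 := by
  have hK : IsCompact (closure X) := hXb.isCompact_closure
  have hF : IsCompact (frontier X) :=
    hK.of_isClosed_subset isClosed_frontier frontier_subset_closure
  refine measure_null_of_locally_null _ fun z hz => ?_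
  obtain ⟨w, hw, hdw, hwX⟩ := exists_defining_function hXo hXs hz
  obtain ⟨i, hi⟩ : ∃ i, partialD i w z ≠ 0 := by
    by_contra! h
    refine hdw (ContinuousLinearMap.ext fun ξ => ?_)
    rw [fderiv_apply_eq_sum]
    simp [h]
  have hae := ae_quadA_eq_zero hb hB hK hF hμ hν hkol hw
  refine ⟨frontier X ∩ {y | w y = 0 ∧ partialD i w y ≠ 0}, ?_, measure_mono_null ?_ hae⟩
  · refine inter_mem self_mem_nhdsWithin ?_
    rw [mem_nhdsWithin_iff_eventually]
    filter_upwards [hwX, (continuous_partialD hw i).continuousAt.eventually_ne hi] with y h1 h2 h3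
    exact ⟨h1.2 h3, h2⟩
  · rintro y ⟨-, hy0, hyi⟩ h
    exact (quadA_pos B (hBr y) fun h0 => hyi (congrFun h0 i)).ne' (h hy0)

end BoundaryMass

/-! ### A smoothed minimum of supersolutions -/

section SmoothMin

/-- A `C²` convex approximation of `r ↦ max r 0` from below which vanishes for `r ≤ 0`. -/
noncomputable def smoothPos (ε r : ℝ) : ℝ := ∫ s in (0 : ℝ)..r, Real.smoothTransition (s / ε)

theorem continuous_smoothTransition_div (ε : ℝ) :
    Continuous fun s => Real.smoothTransition (s / ε) :=
  Real.smoothTransition.continuous.comp (continuous_id.div_const ε)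

theorem contDiff_smoothTransition_div (ε : ℝ) :
    ContDiff ℝ 1 fun s => Real.smoothTransition (s / ε) :=
  (Real.smoothTransition.contDiff (n := 1)).comp (contDiff_id.div_const ε)

theorem hasDerivAt_smoothPos (ε r : ℝ) :
    HasDerivAt (smoothPos ε) (Real.smoothTransition (r / ε)) r :=
  intervalIntegral.integral_hasDerivAt_right
    ((continuous_smoothTransition_div ε).intervalIntegrable _ _)
    (continuous_smoothTransition_div ε).stronglyMeasurable.stronglyMeasurableAtFilter
    (continuous_smoothTransition_div ε).continuousAt

theorem contDiff_smoothPos (ε : ℝ) : ContDiff ℝ 2 (smoothPos ε) := by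
  have h : deriv (smoothPos ε) = fun s => Real.smoothTransition (s / ε) :=
    funext fun r => (hasDerivAt_smoothPos ε r).deriv
  rw [show (2 : WithTop ℕ∞) = 1 + 1 by norm_num, contDiff_succ_iff_deriv]
  refine ⟨fun r => (hasDerivAt_smoothPos ε r).differentiableAt, by simp, ?_⟩
  rw [h]
  exact contDiff_smoothTransition_div ε

theorem smoothPos_of_nonpos {ε r : ℝ} (hε : 0 < ε) (hr : r ≤ 0) : smoothPos ε r = 0 := by
  rw [smoothPos, intervalIntegral.integral_symm, intervalIntegral.integral_congr (g := fun _ => 0)]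
  · simp
  · intro s hs
    rw [uIcc_of_le hr] at hs
    exact Real.smoothTransition.zero_of_nonpos (div_nonpos_of_nonpos_of_nonneg hs.2 hε.le)

theorem smoothPos_nonneg {ε r : ℝ} (hε : 0 < ε) : 0 ≤ smoothPos ε r := by
  rcases le_total r 0 with hr | hr
  · exact (smoothPos_of_nonpos hε hr).ge
  · exact intervalIntegral.integral_nonneg hr fun s _ => Real.smoothTransition.nonneg _

theorem smoothPos_le {ε r : ℝ} (hr : 0 ≤ r) : smoothPos ε r ≤ r := by
  have := intervalIntegral.integral_mono_on hr
    ((continuous_smoothTransition_div ε).intervalIntegrable 0 r)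
    ((continuous_const (y := (1 : ℝ))).intervalIntegrable (μ := volume) 0 r)
    fun s _ => Real.smoothTransition.le_one _
  simpa [smoothPos] using this

theorem sub_le_smoothPos {ε r : ℝ} (hε : 0 < ε) : r - ε ≤ smoothPos ε r := by
  rcases le_total r ε with hr | hr
  · linarith [smoothPos_nonneg (r := r) hε]
  have hint := fun a b => (continuous_smoothTransition_div ε).intervalIntegrable (μ := volume) a b
  have h1 : smoothPos ε r = smoothPos ε ε + ∫ s in ε..r, Real.smoothTransition (s / ε) :=
    (intervalIntegral.integral_add_adjacent_intervals (hint 0 ε) (hint ε r)).symm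
  have h2 : ∫ s in ε..r, Real.smoothTransition (s / ε) = r - ε := by
    rw [intervalIntegral.integral_congr (g := fun _ => 1)]
    · simp
    · intro s hs
      rw [uIcc_of_le hr] at hs
      exact Real.smoothTransition.one_of_one_le ((one_le_div hε).2 hs.1)
  linarith [smoothPos_nonneg (r := ε) hε]

variable {n m : ℕ} (b : EuclideanSpace ℝ (Fin n) → EuclideanSpace ℝ (Fin n))
  (B : EuclideanSpace ℝ (Fin n) → Matrix (Fin n) (Fin m) ℝ)

/-- With s = `smoothPos ε`, the result is (1 - s')Lu + s'Lv + s''·∇(u - v)ᵀA∇(u - v), and every term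
is nonnegative because 0 ≤ s' ≤ 1 and s is convex. -/
theorem opL_smoothMin_nonneg {u v : EuclideanSpace ℝ (Fin n) → ℝ} {y : EuclideanSpace ℝ (Fin n)}
    {ε : ℝ} (hε : 0 < ε) (hu : ContDiffAt ℝ 2 u y) (hv : ContDiffAt ℝ 2 v y)
    (hLu : 0 ≤ opL b B u y) (hLv : 0 ≤ opL b B v y) :
    0 ≤ opL b B (fun z => u z - smoothPos ε (u z - v z)) y := by
  have huv : ContDiffAt ℝ 2 (fun z => u z - v z) y := hu.sub hv
  have hσ : ∀ t, HasDerivAt (fun s => Real.smoothTransition (s / ε))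
      (deriv (fun s => Real.smoothTransition (s / ε)) t) t := fun t =>
    ((contDiff_smoothTransition_div ε).differentiable (by norm_num) t).hasDerivAt
  have hmono : Monotone fun s => Real.smoothTransition (s / ε) := fun s t hst =>
    Real.smoothTransition.monotone (by gcongr)
  have h := opL_comp b B (θ := smoothPos ε) (fun t => hasDerivAt_smoothPos ε t) hσ huv
  have hcomp : ContDiffAt ℝ 2 (fun z => smoothPos ε (u z - v z)) y :=
    (contDiff_smoothPos ε).contDiffAt.comp y huv
  rw [opL_sub b B hu hcomp, h, opL_sub b B hu hv]
  have h0 := Real.smoothTransition.nonneg ((u y - v y) / ε)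
  have h1 := Real.smoothTransition.le_one ((u y - v y) / ε)
  have h2 := mul_nonneg (hmono.deriv_nonneg (x := u y - v y))
    (quadA_nonneg (y := y) B (fun i => partialD i (fun z => u z - v z) y))
  have h3 := mul_nonneg h0 hLv
  have h4 := mul_nonneg (sub_nonneg.2 h1) hLu
  linarith

end SmoothMin

/-! ### Barriers and gluing at the boundary -/

section Barrier

variable {n m : ℕ} {b : EuclideanSpace ℝ (Fin n) → EuclideanSpace ℝ (Fin n)}
  {B : EuclideanSpace ℝ (Fin n) → Matrix (Fin n) (Fin m) ℝ}
  {X : Set (EuclideanSpace ℝ (Fin n))}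

/-- The derivative is locally Lipschitz, so the mean value inequality on the ball of radius ‖y - z‖
gives a quadratic error. -/
theorem exists_quadratic_lower_bound {E : Type*} [NormedAddCommGroup E] [NormedSpace ℝ E]
    {w : E → ℝ} (hw : ContDiff ℝ 2 w) (z : E) :
    ∃ C : ℝ, 0 ≤ C ∧ ∀ᶠ y in 𝓝 z, w z + fderiv ℝ w z (y - z) - C * ‖y - z‖ ^ 2 ≤ w y := by
  obtain ⟨C, t, ht, hlip⟩ :=
    ((hw.fderiv_right (m := 1) (by norm_num)).contDiffAt (x := z)).exists_lipschitzOnWith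
  obtain ⟨r, hr, hrt⟩ := Metric.mem_nhds_iff.1 ht
  refine ⟨C, C.2, ?_⟩
  filter_upwards [Metric.ball_mem_nhds z hr] with y hy
  have hsub : Metric.closedBall z ‖y - z‖ ⊆ t :=
    (Metric.closedBall_subset_ball (by rwa [← dist_eq_norm])).trans hrt
  have := (convex_closedBall z ‖y - z‖).norm_image_sub_le_of_norm_hasFDerivWithin_le'
    (f := w) (f' := fderiv ℝ w) (φ := fderiv ℝ w z) (C := C * ‖y - z‖) (x := z) (y := y)
    (fun q _ => ((hw.differentiable (by norm_num)) q).hasFDerivAt.hasFDerivWithinAt)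
    (fun q hq => (hlip.norm_sub_le (hsub hq) (mem_of_mem_nhds ht)).trans
      (mul_le_mul_of_nonneg_left (by rwa [← dist_eq_norm]) C.2))
    (Metric.mem_closedBall_self (norm_nonneg _)) (by simp [dist_eq_norm])
  have h2 := (abs_le.1 (this : |_| ≤ _)).1
  nlinarith

/-- The centre is z + tN, with N the gradient of a defining function w at z. A point y of the
closure inside the closed ball satisfies ‖y - z‖² ≤ 2t⟨N, y - z⟩, while w(y) ≤ 0 and the Taylor
bound give ⟨N, y - z⟩ ≤ C‖y - z‖². For 2tC < 1 this forces y = z. -/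
theorem exists_exterior_ball (hXo : IsOpen X) (hXs : HasSmoothBoundary X)
    {z : EuclideanSpace ℝ (Fin n)} (hz : z ∈ frontier X) :
    ∃ (y₀ : EuclideanSpace ℝ (Fin n)), 0 < ‖z - y₀‖ ∧
      ∀ y ∈ closure X, y ≠ z → ‖z - y₀‖ < ‖y - y₀‖ := by
  obtain ⟨w, hw, hdw, hwX⟩ := exists_defining_function hXo hXs hz
  obtain ⟨C, hC, hCw⟩ := exists_quadratic_lower_bound hw z
  obtain ⟨r, hr, hrw⟩ := Metric.eventually_nhds_iff.1 (hwX.and hCw)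
  have hwz : w z = 0 := (hrw (by simpa using hr)).1.2 hz
  set N := (InnerProductSpace.toDual ℝ (EuclideanSpace ℝ (Fin n))).symm (fderiv ℝ w z) with hN
  have hNw : ∀ ξ, fderiv ℝ w z ξ = inner ℝ N ξ := fun ξ => by
    rw [hN, InnerProductSpace.toDual_symm_apply]
  have hN0 : 0 < ‖N‖ := by
    rw [norm_pos_iff]
    intro h
    refine hdw (ContinuousLinearMap.ext fun ξ => ?_)
    rw [hNw, h]
    simp
  -- The second condition keeps the ball, of diameter 2t‖N‖, in the neighbourhood where the local
  -- estimates hold.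
  obtain ⟨t, ht, ht1, ht2⟩ : ∃ t > 0, 2 * t * C < 1 ∧ 2 * t * ‖N‖ < r := by
    refine ⟨min (1 / (4 * (C + 1))) (r / (4 * ‖N‖)), by positivity, ?_, ?_⟩
    · calc 2 * min (1 / (4 * (C + 1))) (r / (4 * ‖N‖)) * C
          ≤ 2 * (1 / (4 * (C + 1))) * C := by gcongr; exact min_le_left _ _
        _ < 1 := by
          rw [mul_one_div, div_mul_eq_mul_div, div_lt_one (by positivity)]
          linarith
    · calc 2 * min (1 / (4 * (C + 1))) (r / (4 * ‖N‖)) * ‖N‖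
          ≤ 2 * (r / (4 * ‖N‖)) * ‖N‖ := by gcongr; exact min_le_right _ _
        _ = r / 2 := by field_simp; norm_num
        _ < r := by linarith
  have hR : ‖z - (z + t • N)‖ = t * ‖N‖ := by
    rw [sub_add_cancel_left, norm_neg, norm_smul, Real.norm_of_nonneg ht.le]
  refine ⟨z + t • N, by rw [hR]; positivity, fun y hy hyz => ?_⟩
  rw [hR]
  by_contra! hle
  have e1 : y - (z + t • N) = (y - z) - t • N := by abel
  rw [e1] at hle
  have e2 : ‖y - z‖ ≤ 2 * t * ‖N‖ := by
    have := norm_sub_norm_le (y - z) (t • N)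
    rw [norm_smul, Real.norm_of_nonneg ht.le] at this
    linarith
  have e3 : ‖y - z‖ ^ 2 ≤ 2 * t * inner ℝ N (y - z) := by
    have h1 : ‖(y - z) - t • N‖ ^ 2 ≤ (t * ‖N‖) ^ 2 := by gcongr
    rw [norm_sub_sq_real, norm_smul, Real.norm_of_nonneg ht.le, real_inner_smul_right,
      real_inner_comm] at h1
    linarith
  obtain ⟨h4, h5⟩ := hrw (show dist y z < r by rw [dist_eq_norm]; linarith)
  have h6 := h4.1 hy
  rw [hwz, hNw] at h5
  have h7 : 0 < ‖y - z‖ ^ 2 := by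
    have : 0 < ‖y - z‖ := norm_pos_iff.2 (sub_ne_zero.2 hyz)
    positivity
  have h8 : 2 * t * inner ℝ N (y - z) ≤ 2 * t * (C * ‖y - z‖ ^ 2) :=
    mul_le_mul_of_nonneg_left (by linarith) (by positivity)
  nlinarith

theorem exists_barrier (hb : Continuous b) (hB : Continuous B) (hBr : ∀ y, (B y).rank = n)
    (hXo : IsOpen X) (hXb : Bornology.IsBounded X) (hXs : HasSmoothBoundary X)
    {z : EuclideanSpace ℝ (Fin n)} (hz : z ∈ frontier X) :
    ∃ β : EuclideanSpace ℝ (Fin n) → ℝ, ContDiff ℝ 2 β ∧ (∀ y ∈ X, 0 ≤ opL b B β y) ∧ β z = 0 ∧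
      ∀ y ∈ closure X, y ≠ z → 0 < β y := by
  obtain ⟨y₀, hR, hy₀⟩ := exists_exterior_ball hXo hXs hz
  obtain ⟨l, hl, hL⟩ := exists_opL_neg_exp_pos (b := b) hb hB hBr hXb.isCompact_closure hR
    (fun y hy => by
      rcases eq_or_ne y z with rfl | h
      · exact le_rfl
      · exact (hy₀ y hy h).le)
  have hφ : ContDiff ℝ 2 fun y : EuclideanSpace ℝ (Fin n) => -Real.exp (-l * ‖y - y₀‖ ^ 2) :=
    (contDiff_const.mul (contDiff_norm_sub_sq y₀)).exp.neg
  refine ⟨fun y => -Real.exp (-l * ‖y - y₀‖ ^ 2) + Real.exp (-l * ‖z - y₀‖ ^ 2),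
    hφ.add contDiff_const, fun y hy => ?_, by simp, fun y hy hyz => ?_⟩
  · rw [opL_add b B hφ.contDiffAt contDiffAt_const, opL_const, add_zero]
    exact (hL y (subset_closure hy)).le
  · have h1 := hy₀ y hy hyz
    have h2 : ‖z - y₀‖ ^ 2 < ‖y - y₀‖ ^ 2 := by gcongr
    have h3 : Real.exp (-l * ‖y - y₀‖ ^ 2) < Real.exp (-l * ‖z - y₀‖ ^ 2) :=
      Real.exp_lt_exp.2 (by nlinarith)
    linarith

/-- Add a multiple of the barrier at z to the constant g(z) + δ. Near z continuity of g suffices.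
Away from z the barrier is at least c > 0, and the factor 2M/c covers the oscillation of g, where
|g| ≤ M. -/
theorem exists_supersolution_at (hb : Continuous b) (hB : Continuous B)
    (hBr : ∀ y, (B y).rank = n) (hXo : IsOpen X) (hXb : Bornology.IsBounded X)
    (hXs : HasSmoothBoundary X) {g : EuclideanSpace ℝ (Fin n) → ℝ}
    (hg : ContinuousOn g (frontier X)) {z : EuclideanSpace ℝ (Fin n)} (hz : z ∈ frontier X)
    {δ : ℝ} (hδ : 0 < δ) :
    ∃ u : EuclideanSpace ℝ (Fin n) → ℝ, ContDiff ℝ 2 u ∧ IsSuper X b B g u ∧ u z = g z + δ := by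
  have hF : IsCompact (frontier X) :=
    hXb.isCompact_closure.of_isClosed_subset isClosed_frontier frontier_subset_closure
  obtain ⟨β, hβ, hβL, hβz, hβpos⟩ := exists_barrier (b := b) hb hB hBr hXo hXb hXs hz
  obtain ⟨V, hV, hzV, hVg⟩ : ∃ V, IsOpen V ∧ z ∈ V ∧ ∀ y ∈ V ∩ frontier X, g y < g z + δ :=
    mem_nhdsWithin.1 ((hg z hz).eventually_lt_const (by linarith))
  have hS : IsCompact (frontier X \ V) := hF.diff hV
  obtain ⟨c, hc, hcβ⟩ := hS.exists_forall_le' hβ.continuous.continuousOn (a := 0)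
    (fun y hy => hβpos y (frontier_subset_closure hy.1) fun h => hy.2 (h ▸ hzV))
  obtain ⟨M, hM⟩ := hF.exists_bound_of_continuousOn hg
  have hM0 : 0 ≤ M := (norm_nonneg _).trans (hM z hz)
  have hCβ : ContDiff ℝ 2 fun y => 2 * M / c * β y := contDiff_const.mul hβ
  refine ⟨fun y => 2 * M / c * β y + (g z + δ), hCβ.add contDiff_const,
    ⟨fun y hy => ?_, fun y hy => ?_⟩, by simp [hβz]⟩
  · rw [opL_add b B hCβ.contDiffAt contDiffAt_const, opL_const,
      opL_const_mul b B _ hβ.contDiffAt, add_zero]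
    exact mul_nonneg (by positivity) (hβL y hy)
  · by_cases hyV : y ∈ V
    · have h1 : 0 ≤ β y := by
        rcases eq_or_ne y z with rfl | h
        · exact hβz.ge
        · exact (hβpos y (frontier_subset_closure hy) h).le
      have h2 : 0 ≤ 2 * M / c * β y := by positivity
      linarith [hVg y ⟨hyV, hy⟩]
    · have h1 : 2 * M / c * c ≤ 2 * M / c * β y := by
        have := hcβ y ⟨hy, hyV⟩
        gcongr
      rw [div_mul_cancel₀ _ hc.ne'] at h1
      have h2 := (abs_le.1 (hM y hy)).2
      have h3 := (abs_le.1 (hM z hz)).1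
      linarith

/-- Supersolutions close to g near single points are combined over the compact boundary by smoothed
minima. -/
theorem exists_supersolution_near (hb : Continuous b) (hB : Continuous B)
    (hBr : ∀ y, (B y).rank = n) (hXo : IsOpen X) (hXb : Bornology.IsBounded X)
    (hXs : HasSmoothBoundary X) {g : EuclideanSpace ℝ (Fin n) → ℝ}
    (hg : ContinuousOn g (frontier X)) {δ : ℝ} (hδ : 0 < δ) :
    ∃ u : EuclideanSpace ℝ (Fin n) → ℝ, ContDiff ℝ 2 u ∧ IsSuper X b B g u ∧
      ∀ y ∈ frontier X, u y < g y + δ := by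
  have hF : IsCompact (frontier X) :=
    hXb.isCompact_closure.of_isClosed_subset isClosed_frontier frontier_subset_closure
  obtain ⟨M, hM⟩ := hF.exists_bound_of_continuousOn hg
  -- Each smoothed minimum may exceed the true one by its ε, so the inductive statement keeps strict
  -- slack δ' < δ to absorb it.
  suffices h : ∃ δ' < δ, ∃ u : EuclideanSpace ℝ (Fin n) → ℝ, ContDiff ℝ 2 u ∧
      IsSuper X b B g u ∧ ∀ y ∈ frontier X, u y ≤ g y + δ' by
    obtain ⟨δ', hδ', u, hu, hus, hub⟩ := h
    exact ⟨u, hu, hus, fun y hy => (hub y hy).trans_lt (by linarith)⟩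
  refine hF.induction_on (p := fun S => ∃ δ' < δ, ∃ u : EuclideanSpace ℝ (Fin n) → ℝ,
    ContDiff ℝ 2 u ∧ IsSuper X b B g u ∧ ∀ y ∈ S, u y ≤ g y + δ') ?_ ?_ ?_ ?_
  · refine ⟨0, hδ, fun _ => M, contDiff_const, ⟨fun y _ => (opL_const b B M).ge, fun y hy => ?_⟩,
      fun y hy => absurd hy (notMem_empty y)⟩
    exact (le_abs_self _).trans (hM y hy)
  · rintro S T hST ⟨δ', hδ', u, hu, hus, hub⟩
    exact ⟨δ', hδ', u, hu, hus, fun y hy => hub y (hST hy)⟩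
  · rintro S T ⟨δ₁, hδ₁, u, hu, hus, hub⟩ ⟨δ₂, hδ₂, v, hv, hvs, hvb⟩
    set ε : ℝ := (δ - δ₂) / 2 with hε
    have hεpos : 0 < ε := by rw [hε]; linarith
    refine ⟨max δ₁ (δ₂ + ε), max_lt hδ₁ (by rw [hε]; linarith),
      fun z => u z - smoothPos ε (u z - v z),
      hu.sub ((contDiff_smoothPos ε).comp (hu.sub hv)), ⟨fun y hy => ?_, fun y hy => ?_⟩, ?_⟩
    · exact opL_smoothMin_nonneg b B hεpos hu.contDiffAt hv.contDiffAt (hus.1 y hy) (hvs.1 y hy)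
    · change g y ≤ u y - smoothPos ε (u y - v y)
      rcases le_total (u y - v y) 0 with h | h
      · rw [smoothPos_of_nonpos hεpos h]
        linarith [hus.2 y hy]
      · linarith [smoothPos_le (ε := ε) h, hvs.2 y hy]
    · rintro y (hy | hy)
      · linarith [hub y hy, smoothPos_nonneg (r := u y - v y) hεpos, le_max_left δ₁ (δ₂ + ε)]
      · linarith [hvb y hy, sub_le_smoothPos (r := u y - v y) hεpos, le_max_right δ₁ (δ₂ + ε)]
  · intro z hz
    obtain ⟨u, hu, hus, huz⟩ := exists_supersolution_at (b := b) hb hB hBr hXo hXb hXs hg hz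
      (half_pos (half_pos hδ))
    have h1 : ∀ᶠ y in 𝓝[frontier X] z, u y - g y < δ / 2 :=
      (hu.continuous.continuousWithinAt.sub (hg z hz)).eventually_lt_const
        (by change u z - g z < δ / 2; linarith)
    exact ⟨{y | u y - g y < δ / 2}, h1, δ / 2, by linarith, u, hu, hus, fun y hy => by
      have : u y - g y < δ / 2 := hy
      linarith⟩

/-- The smoothed minimum of u and v + δ/2 coincides with u wherever u ≤ v + δ/2. This holds in X
near ∂X, because u < g + δ/2 ≤ v + δ/2 on ∂X and v is continuous up to the boundary. Extending by u
outside X therefore keeps C² regularity, although v has none across ∂X. -/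
theorem exists_contDiff_supersolution_le (hb : Continuous b) (hB : Continuous B)
    (hBr : ∀ y, (B y).rank = n) (hXo : IsOpen X) (hXb : Bornology.IsBounded X)
    (hXs : HasSmoothBoundary X) {g : EuclideanSpace ℝ (Fin n) → ℝ}
    (hg : ContinuousOn g (frontier X)) {v : EuclideanSpace ℝ (Fin n) → ℝ} (hv : IsC2 X v)
    (hvs : IsSuper X b B g v) {δ : ℝ} (hδ : 0 < δ) :
    ∃ f : EuclideanSpace ℝ (Fin n) → ℝ, ContDiff ℝ 2 f ∧ IsSuper X b B g f ∧
      ∀ y ∈ X, f y ≤ v y + δ := by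
  obtain ⟨u, hu, hus, hub⟩ := exists_supersolution_near (b := b) hb hB hBr hXo hXb hXs hg
    (half_pos hδ)
  have hvX : ∀ y ∈ X, ContDiffAt ℝ 2 v y := fun y hy => hv.1.contDiffAt (hXo.mem_nhds hy)
  set φ : EuclideanSpace ℝ (Fin n) → ℝ := fun z =>
    u z - smoothPos (δ / 2) (u z - (v z + δ / 2)) with hφ
  classical
  set f : EuclideanSpace ℝ (Fin n) → ℝ := X.piecewise φ u with hf
  have hfX : ∀ y ∈ X, f =ᶠ[𝓝 y] φ := fun y hy => by
    filter_upwards [hXo.mem_nhds hy] with z hz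
    exact piecewise_eq_of_mem _ _ _ hz
  have hfX' : ∀ y ∉ X, f y = u y := fun y hy => piecewise_eq_of_notMem _ _ _ hy
  have hfXc : ∀ y ∉ X, f =ᶠ[𝓝 y] u := fun y hy => by
    have key : ∀ᶠ z in 𝓝 y, z ∈ X → u z - (v z + δ / 2) ≤ 0 := by
      by_cases hyc : y ∈ closure X
      · have hyF : y ∈ frontier X := by rw [hXo.frontier_eq]; exact ⟨hyc, hy⟩
        have h1 : ∀ᶠ z in 𝓝[closure X] y, u z - (v z + δ / 2) < 0 :=
          (hu.continuous.continuousWithinAt.sub ((hv.2 y hyc).add_const (δ / 2))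
            ).eventually_lt_const
              (by change u y - (v y + δ / 2) < 0; linarith [hub y hyF, hvs.2 y hyF])
        filter_upwards [mem_nhdsWithin_iff_eventually.1 h1] with z hz hzX
        exact (hz (subset_closure hzX)).le
      · filter_upwards [isClosed_closure.isOpen_compl.mem_nhds hyc] with z hz hzX
        exact absurd (subset_closure hzX) hz
    filter_upwards [key] with z hz
    by_cases hzX : z ∈ X
    · rw [(hfX z hzX).eq_of_nhds, hφ]
      simp only
      rw [smoothPos_of_nonpos (half_pos hδ) (hz hzX), sub_zero]
    · exact hfX' z hzX
  have hvδ : ∀ y ∈ X, ContDiffAt ℝ 2 (fun z => v z + δ / 2) y := fun y hy =>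
    (hvX y hy).add contDiffAt_const
  refine ⟨f, contDiff_iff_contDiffAt.2 fun y => ?_, ⟨fun y hy => ?_, fun y hy => ?_⟩,
    fun y hy => ?_⟩
  · by_cases hy : y ∈ X
    · refine ContDiffAt.congr_of_eventuallyEq ?_ (hfX y hy)
      exact hu.contDiffAt.sub
        ((contDiff_smoothPos (δ / 2)).contDiffAt.comp y (hu.contDiffAt.sub (hvδ y hy)))
    · exact hu.contDiffAt.congr_of_eventuallyEq (hfXc y hy)
  · rw [opL_congr b B (hfX y hy)]
    refine opL_smoothMin_nonneg b B (half_pos hδ) hu.contDiffAt (hvδ y hy) (hus.1 y hy) ?_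
    rw [opL_add b B (hvX y hy) contDiffAt_const, opL_const, add_zero]
    exact hvs.1 y hy
  · rw [hXo.frontier_eq] at hy
    rw [hfX' y hy.2]
    exact hus.2 y (by rw [hXo.frontier_eq]; exact hy)
  · rw [(hfX y hy).eq_of_nhds]
    have := sub_le_smoothPos (r := u y - (v y + δ / 2)) (half_pos hδ)
    simp only [hφ]
    linarith

end Barrier

/-! ### The Lagrangian dual functions and the two duality theorems -/

section Lagrangian

variable {n m : ℕ} {b : EuclideanSpace ℝ (Fin n) → EuclideanSpace ℝ (Fin n)}
  {B : EuclideanSpace ℝ (Fin n) → Matrix (Fin n) (Fin m) ℝ}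
  {X : Set (EuclideanSpace ℝ (Fin n))} {g v : EuclideanSpace ℝ (Fin n) → ℝ}
  {x : EuclideanSpace ℝ (Fin n)}
  {p : Measure (EuclideanSpace ℝ (Fin n)) × Measure (EuclideanSpace ℝ (Fin n))}

theorem isSuper_neg_iff (hv : ∀ y ∈ X, ContDiffAt ℝ 2 v y) :
    IsSuper X b B (fun y => -g y) (fun y => -v y) ↔ IsSub X b B g v := by
  refine and_congr (forall₂_congr fun y hy => ?_) (forall₂_congr fun y _ => neg_le_neg_iff)
  rw [opL_neg b B (hv y hy), neg_nonneg]

theorem integral_le_of_isSuper (hXb : Bornology.IsBounded X) (hg : ContinuousOn g (frontier X))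
    (hv : ContDiff ℝ 2 v) (hvs : IsSuper X b B g v) (hp : p ∈ measurePairs X) :
    ∫ y, g y ∂p.2 ≤ ∫ y, v y ∂p.2 ∧ 0 ≤ ∫ y, opL b B v y ∂p.1 := by
  obtain ⟨h1, h2, h3, h4⟩ := hp
  have hF : IsCompact (frontier X) :=
    hXb.isCompact_closure.of_isClosed_subset isClosed_frontier frontier_subset_closure
  refine ⟨integral_mono_ae (integrable_of_continuousOn_compact hF h4 hg)
    (integrable_of_continuousOn_compact hF h4 hv.continuous.continuousOn) ?_,
    integral_nonneg_of_ae ?_⟩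
  · filter_upwards [mem_ae_iff.2 h4] with y hy using hvs.2 y hy
  · filter_upwards [mem_ae_iff.2 h3] with y hy using hvs.1 y hy

theorem lagrangian_le_of_isSuper (hXb : Bornology.IsBounded X)
    (hg : ContinuousOn g (frontier X)) (hv : ContDiff ℝ 2 v) (hvs : IsSuper X b B g v)
    (hp : p ∈ measurePairs X) : lagrangian b B g x p v ≤ v x := by
  have := integral_le_of_isSuper hXb hg hv hvs hp
  rw [lagrangian]
  linarith

theorem le_of_mem_primalValues (hXb : Bornology.IsBounded X)
    (hg : ContinuousOn g (frontier X)) (hv : ContDiff ℝ 2 v) (hvs : IsSuper X b B g v) {c : ℝ}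
    (hc : c ∈ primalValues X b B g x) : c ≤ v x := by
  obtain ⟨p, hp, hkol, rfl⟩ := hc
  have h1 := integral_le_of_isSuper hXb hg hv hvs hp
  have h2 := hkol v hv
  linarith

theorem zero_mem_measurePairs : (0, 0) ∈ measurePairs X :=
  ⟨inferInstanceAs (IsFiniteMeasure 0), inferInstanceAs (IsFiniteMeasure 0), rfl, rfl⟩

theorem lagrangian_zero : lagrangian b B g x (0, 0) v = v x := by
  simp [lagrangian]

theorem smul_dirac_compl_eq_zero {S : Set (EuclideanSpace ℝ (Fin n))}
    {y : EuclideanSpace ℝ (Fin n)} (hS : MeasurableSet S) (hy : y ∈ S) (t : ENNReal) :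
    (t • Measure.dirac y) Sᶜ = 0 := by
  simp [Measure.dirac_apply' y hS.compl, hy]

/-- A Dirac mass of weight t at a point violating a constraint, in ν for the boundary constraint and
in μ for the interior one, adds t times the positive violation. -/
theorem exists_lt_lagrangian_of_not_isSuper (hXo : IsOpen X) (hvs : ¬ IsSuper X b B g v) (c : ℝ) :
    ∃ p ∈ measurePairs X, c < lagrangian b B g x p v := by
  have key : ∀ a : ℝ, 0 < a → ∃ t : ℝ, 0 ≤ t ∧ c < v x + t * a := fun a ha => by
    refine ⟨(|c - v x| + 1) / a, by positivity, ?_⟩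
    rw [div_mul_cancel₀ _ ha.ne']
    linarith [le_abs_self (c - v x)]
  by_cases h1 : ∀ y ∈ X, 0 ≤ opL b B v y
  · obtain ⟨y, hy, hlt⟩ : ∃ y ∈ frontier X, v y < g y := by
      by_contra! h2
      exact hvs ⟨h1, h2⟩
    obtain ⟨t, ht, hct⟩ := key (g y - v y) (by linarith)
    refine ⟨(0, ENNReal.ofReal t • Measure.dirac y), ⟨inferInstanceAs (IsFiniteMeasure 0),
      (Measure.dirac y).smul_finite ENNReal.ofReal_ne_top, rfl,
      smul_dirac_compl_eq_zero isClosed_frontier.measurableSet hy _⟩, ?_⟩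
    simp only [lagrangian, integral_smul_measure, integral_dirac, integral_zero_measure,
      ENNReal.toReal_ofReal ht, smul_eq_mul]
    linarith
  · push Not at h1
    obtain ⟨y, hy, hlt⟩ := h1
    obtain ⟨t, ht, hct⟩ := key (-opL b B v y) (by linarith)
    refine ⟨(ENNReal.ofReal t • Measure.dirac y, 0),
      ⟨(Measure.dirac y).smul_finite ENNReal.ofReal_ne_top, inferInstanceAs (IsFiniteMeasure 0),
      smul_dirac_compl_eq_zero hXo.measurableSet hy _, rfl⟩, ?_⟩
    simp only [lagrangian, integral_smul_measure, integral_dirac, integral_zero_measure,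
      ENNReal.toReal_ofReal ht, smul_eq_mul]
    linarith

theorem lagrangian_neg (hv : ContDiff ℝ 2 v) :
    lagrangian b B (fun y => -g y) x p (fun y => -v y) = -lagrangian b B g x p v := by
  have h : opL b B (fun y => -v y) = fun y => -opL b B v y :=
    funext fun y => opL_neg b B hv.contDiffAt
  simp only [lagrangian, h, integral_neg]
  ring

theorem dualFunMax_of_isSuper (hXb : Bornology.IsBounded X) (hg : ContinuousOn g (frontier X))
    (hv : ContDiff ℝ 2 v) (hvs : IsSuper X b B g v) :
    dualFunMax X b B g x v = ((v x : ℝ) : EReal) :=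
  le_antisymm
    (iSup₂_le fun _ hp => EReal.coe_le_coe_iff.2 (lagrangian_le_of_isSuper hXb hg hv hvs hp))
    (le_iSup₂_of_le (0, 0) zero_mem_measurePairs (by rw [lagrangian_zero]))

theorem dualFunMax_of_not_isSuper (hXo : IsOpen X) (hvs : ¬ IsSuper X b B g v) :
    dualFunMax X b B g x v = ⊤ := by
  rw [EReal.eq_top_iff_forall_lt]
  intro c
  obtain ⟨p, hp, hc⟩ := exists_lt_lagrangian_of_not_isSuper (x := x) hXo hvs c
  exact (EReal.coe_lt_coe_iff.2 hc).trans_le (le_iSup₂_of_le p hp le_rfl)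

theorem dualFunMin_of_isSub (hXb : Bornology.IsBounded X) (hg : ContinuousOn g (frontier X))
    (hv : ContDiff ℝ 2 v) (hvs : IsSub X b B g v) :
    dualFunMin X b B g x v = ((v x : ℝ) : EReal) := by
  refine le_antisymm (iInf₂_le_of_le (0, 0) zero_mem_measurePairs (by rw [lagrangian_zero]))
    (le_iInf₂ fun p hp => EReal.coe_le_coe_iff.2 ?_)
  have := lagrangian_le_of_isSuper (x := x) hXb hg.neg hv.neg
    ((isSuper_neg_iff fun y _ => hv.contDiffAt).2 hvs) hp
  have h2 := lagrangian_neg (b := b) (B := B) (g := g) (x := x) (p := p) hv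
  change lagrangian b B (fun y => -g y) x p (fun y => -v y) ≤ -v x at this
  linarith

theorem dualFunMin_of_not_isSub (hXo : IsOpen X) (hv : ContDiff ℝ 2 v)
    (hvs : ¬ IsSub X b B g v) : dualFunMin X b B g x v = ⊥ := by
  rw [EReal.eq_bot_iff_forall_lt]
  intro c
  rw [← isSuper_neg_iff fun y _ => hv.contDiffAt] at hvs
  obtain ⟨p, hp, hc⟩ := exists_lt_lagrangian_of_not_isSuper (x := x) hXo hvs (-c)
  rw [lagrangian_neg hv, neg_lt_neg_iff] at hc
  exact (iInf₂_le p hp).trans_lt (EReal.coe_lt_coe_iff.2 hc)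

theorem isGreatest_primalValues_and_isGLB (hn : 0 < n) (hXo : IsOpen X)
    (hXb : Bornology.IsBounded X) (hXs : HasSmoothBoundary X) (hb : Continuous b)
    (hB : Continuous B) (hBr : ∀ y, (B y).rank = n) (hg : ContinuousOn g (frontier X))
    (hx : x ∈ X) :
    ∃ vmax : ℝ, IsGreatest (primalValues X b B g x) vmax ∧
      IsGLB {c | ∃ v, ContDiff ℝ 2 v ∧ IsSuper X b B g v ∧ c = v x} vmax ∧
      IsGLB {c | ∃ v, IsC2 X v ∧ IsSuper X b B g v ∧ c = v x} vmax := by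
  obtain ⟨μ, ν, hμ, hν, hμK, hνF, hkol, hglb⟩ :=
    exists_kolmogorov_pair_closure hn hXo hXb hb hB hBr hx hg
  have hμF := measure_frontier_eq_zero hb hB hBr hXo hXb hXs hμK hνF hkol
  have hμX : μ Xᶜ = 0 := by
    refine measure_mono_null (fun y hy => ?_) (measure_union_null hμK hμF)
    by_cases hyK : y ∈ closure X
    · exact Or.inr (by rw [hXo.frontier_eq]; exact ⟨hyK, hy⟩)
    · exact Or.inl hyK
  refine ⟨∫ y, g y ∂ν, ⟨⟨(μ, ν), ⟨hμ, hν, hμX, hνF⟩, hkol, rfl⟩, fun c hc => hglb.2 ?_⟩, hglb,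
    ?_, fun c hc => hglb.2 ?_⟩
  · rintro _ ⟨v, hv, hvs, rfl⟩
    exact le_of_mem_primalValues hXb hg hv hvs hc
  · rintro _ ⟨v, hv, hvs, rfl⟩
    refine le_of_forall_pos_le_add fun δ hδ => ?_
    obtain ⟨f, hf, hfs, hfv⟩ := exists_contDiff_supersolution_le hb hB hBr hXo hXb hXs hg hv hvs hδ
    exact (hglb.1 ⟨f, hf, hfs, rfl⟩).trans (hfv x hx)
  · rintro _ ⟨v, hv, hvs, rfl⟩
    exact hc ⟨v, ⟨hv.contDiffOn, hv.continuous.continuousOn⟩, hvs, rfl⟩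

theorem neg_mem_primalValues_iff {c : ℝ} :
    -c ∈ primalValues X b B (fun y => -g y) x ↔ c ∈ primalValues X b B g x := by
  refine exists_congr fun p => and_congr_right fun _ => and_congr_right fun _ => ?_
  rw [integral_neg, neg_inj]

theorem isLeast_primalValues_and_isLUB (hn : 0 < n) (hXo : IsOpen X)
    (hXb : Bornology.IsBounded X) (hXs : HasSmoothBoundary X) (hb : Continuous b)
    (hB : Continuous B) (hBr : ∀ y, (B y).rank = n) (hg : ContinuousOn g (frontier X))
    (hx : x ∈ X) :
    ∃ vmin : ℝ, IsLeast (primalValues X b B g x) vmin ∧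
      IsLUB {c | ∃ v, ContDiff ℝ 2 v ∧ IsSub X b B g v ∧ c = v x} vmin ∧
      IsLUB {c | ∃ v, IsC2 X v ∧ IsSub X b B g v ∧ c = v x} vmin := by
  obtain ⟨a, ⟨ha, ha'⟩, h1, h2⟩ :=
    isGreatest_primalValues_and_isGLB hn hXo hXb hXs hb hB hBr hg.neg hx
  -- `P` stands for either class of dual functions: only invariance under negation and C² regularity
  -- in X are needed.
  have hdual : ∀ P : (EuclideanSpace ℝ (Fin n) → ℝ) → Prop,
      (∀ v, P v → P fun y => -v y) → (∀ v, P v → ∀ y ∈ X, ContDiffAt ℝ 2 v y) →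
      IsGLB {c | ∃ v, P v ∧ IsSuper X b B (fun y => -g y) v ∧ c = v x} a →
      IsLUB {c | ∃ v, P v ∧ IsSub X b B g v ∧ c = v x} (-a) := by
    intro P hP hPC h
    rw [← neg_neg {c | ∃ v, P v ∧ IsSub X b B g v ∧ c = v x}, isLUB_neg']
    have hset : -{c | ∃ v, P v ∧ IsSub X b B g v ∧ c = v x}
        = {c | ∃ v, P v ∧ IsSuper X b B (fun y => -g y) v ∧ c = v x} := by
      ext c
      constructor
      · rintro ⟨v, hv, hvs, hc⟩
        exact ⟨_, hP v hv, (isSuper_neg_iff (hPC v hv)).2 hvs, by rw [← hc, neg_neg]⟩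
      · rintro ⟨v, hv, hvs, rfl⟩
        refine ⟨_, hP v hv, (isSuper_neg_iff (hPC _ (hP v hv))).1 ?_, rfl⟩
        simpa only [neg_neg] using hvs
    rw [hset]
    exact h
  refine ⟨-a, ⟨?_, fun c hc => ?_⟩, hdual (fun v => ContDiff ℝ 2 v) (fun v hv => hv.neg)
    (fun v hv y _ => hv.contDiffAt) h1, hdual (fun v => IsC2 X v)
    (fun v hv => ⟨hv.1.neg, hv.2.neg⟩) (fun v hv y hy => hv.1.contDiffAt (hXo.mem_nhds hy)) h2⟩
  · rw [← neg_mem_primalValues_iff, neg_neg]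
    exact ha
  · have := ha' (neg_mem_primalValues_iff.2 hc)
    linarith

end Lagrangian

end ExitLP

theorem lemma2 {n m : ℕ} (hn : 0 < n)
    (X : Set (EuclideanSpace ℝ (Fin n))) (hXo : IsOpen X) (hXb : Bornology.IsBounded X)
    (hXs : ExitLP.HasSmoothBoundary X)
    (b : EuclideanSpace ℝ (Fin n) → EuclideanSpace ℝ (Fin n)) (hb : Continuous b)
    (B : EuclideanSpace ℝ (Fin n) → Matrix (Fin n) (Fin m) ℝ) (hB : Continuous B)
    (hBr : ∀ y, (B y).rank = n)
    (g : EuclideanSpace ℝ (Fin n) → ℝ) (hg : ContinuousOn g (frontier X))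
    (x : EuclideanSpace ℝ (Fin n)) (hx : x ∈ X) :
    -- the Lagrange dual of the minimization problem is: maximize `v x` over subsolutions
    (∀ v : EuclideanSpace ℝ (Fin n) → ℝ, ContDiff ℝ 2 v →
      (ExitLP.IsSub X b B g v → ExitLP.dualFunMin X b B g x v = ((v x : ℝ) : EReal)) ∧
      (¬ ExitLP.IsSub X b B g v → ExitLP.dualFunMin X b B g x v = ⊥)) ∧
    -- no duality gap, for `v` in `C²(closure X)` as well as in `C²(X) ∩ C(closure X)`
    (∃ vmin : ℝ, IsLeast (ExitLP.primalValues X b B g x) vmin ∧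
      IsLUB {c | ∃ v, ContDiff ℝ 2 v ∧ ExitLP.IsSub X b B g v ∧ c = v x} vmin ∧
      IsLUB {c | ∃ v, ExitLP.IsC2 X v ∧ ExitLP.IsSub X b B g v ∧ c = v x} vmin) ∧
    -- the Lagrange dual of the maximization problem is: minimize `v x` over supersolutions
    (∀ v : EuclideanSpace ℝ (Fin n) → ℝ, ContDiff ℝ 2 v →
      (ExitLP.IsSuper X b B g v → ExitLP.dualFunMax X b B g x v = ((v x : ℝ) : EReal)) ∧
      (¬ ExitLP.IsSuper X b B g v → ExitLP.dualFunMax X b B g x v = ⊤)) ∧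
    -- no duality gap
    (∃ vmax : ℝ, IsGreatest (ExitLP.primalValues X b B g x) vmax ∧
      IsGLB {c | ∃ v, ContDiff ℝ 2 v ∧ ExitLP.IsSuper X b B g v ∧ c = v x} vmax ∧
      IsGLB {c | ∃ v, ExitLP.IsC2 X v ∧ ExitLP.IsSuper X b B g v ∧ c = v x} vmax) := by
  refine ⟨fun v hv => ⟨ExitLP.dualFunMin_of_isSub hXb hg hv, ExitLP.dualFunMin_of_not_isSub hXo hv⟩,
    ExitLP.isLeast_primalValues_and_isLUB hn hXo hXb hXs hb hB hBr hg hx,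
    fun v hv => ⟨ExitLP.dualFunMax_of_isSuper hXb hg hv, ExitLP.dualFunMax_of_not_isSuper hXo⟩,
    ExitLP.isGreatest_primalValues_and_isGLB hn hXo hXb hXs hb hB hBr hg hx⟩
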